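/- Let $m\ge 6$ be even, let $F$ be a field with $2^{m-1}$ elements, let $\sigma=2^s$ with $\gcd(s,m-1)=1$ (for instance $s=1$), and identify the coordinate set $\mathbb F_2^m$ with $F\times\mathbb F_2$ by an $\mathbb F_2$-linear isomorphism. The Preparata code $P(m)\subset\mathbb F_2^{2^m}$ consists of the words given by pairs $(X,Y)$ of subsets of $F$ (the parts of the support in $F\times\{0\}$ and $F\times\{1\}$) such that $|X|$ and $|Y|$ are even, $\sum_{x\in X}x=\sum_{y\in Y}y$, and $\sum_{x\in X}x^{\sigma+1}+\bigl(\sum_{x\in X}x\bigr)^{\sigma+1}=\sum_{y\in Y}y^{\sigma+1}$. Let $R=\mathrm{RM}(m-3,m)$ be the Reed–Muller code of the value vectors on $\mathbb F_2^m$ of polynomials of degree at most $m-3$. For $a,b\in\mathbb F_2^{2^m}$ write $X^aZ^b=\bigotimes_i\sigma_x^{a_i}\sigma_z^{b_i}$ on $(\mathbb C^2)^{\otimes 2^m}$; its weight is the number of $i$ with $(a_i,b_i)\neq(0,0)$. A code (subspace) $Q$ of dimension greater than one has minimum distance $d$ if $d$ is the least weight of an operator $E=X^aZ^b$ for which there is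 no $c\in\mathbb C$ with $\langle\varphi|E|\psi\rangle=c\langle\varphi|\psi\rangle$ for all $\varphi,\psi\in Q$; an $((n,K,d))$ code is a $K$-dimensional subspace of $(\mathbb C^2)^{\otimes n}$ with minimum distance $d$. A stabilizer code is a nonzero joint $+1$ eigenspace of a set of commuting operators of the form $i^kX^aZ^b$. Then: 1. $P(m)$ is a disjoint union of cosets of $R$, and the number of these cosets is $K_P=2^{\binom m2-m+1}$. 2. $R^\perp\subseteq R$. Let $\mathcal C_0$ be the CSS code of $R$, i.e. the joint $+1$ eigenspace of all $X^a$ and $Z^b$ with $a,b\in R^\perp$. For all sets $T_1,T_2$ of representatives of the cosets of $R$ in $P(m)$, the CSS-like union code $Q=\bigoplus_{t_1\in T_1,\,t_2\in T_2}X^{t_1}Z^{t_2}\mathcal C_0$ has dimension $K_P^2\dim\mathcal C_0$, is a $((2^m,2^{2^m-4m},6))$ quantum code, and is non-additive, i.e. not a stabilizer code. In particular one obtains $((64,2^{40},6))$ for $m=6$ and $((256,2^{224},6))$ for $m=8$. 3. The dimension of $Q$ exceeds that of the enlarged Reed–Muller stabilizer codes: for every linear complement $D$ of $R$ in $\mathrm{RM}(m-2,m)$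 and every invertible linear map $A:D\to D$ without nonzero fixed points, the code $Q_1=\bigoplus_{v\in D}X^vZ^{Av}\mathcal C_0$ is a stabilizer code of dimension $2^{2^m-\binom m2-2m-2}$ that detects all $X^aZ^b$ of weight less than $6$ (so its minimum distance is at least $6$), and $\dim Q_1<\dim Q$. -/

import Mathlib

open scoped Matrix

namespace UnionCode

noncomputable section

/-! ### Classical binary codes -/

/-- The dual of a linear binary code with respect to the standard dot product. -/
def dualCode {ι : Type*} [Fintype ι] (C : Submodule (ZMod 2) (ι → ZMod 2)) :
    Submodule (ZMod 2) (ι → ZMod 2) where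
  carrier := {v | ∀ c ∈ C, v ⬝ᵥ c = 0}
  add_mem' := by
    intro v w hv hw c hc
    rw [add_dotProduct, hv c hc, hw c hc, add_zero]
  zero_mem' := by
    intro c _
    exact zero_dotProduct c
  smul_mem' := by
    intro r v hv c hc
    rw [smul_dotProduct, hv c hc, smul_zero]

/-- The binary Reed-Muller code `RM(r, m)`: the value vectors on `𝔽₂^m` of the polynomials in `m`
variables of total degree at most `r`. The `2^m` coordinates are indexed by the points of `𝔽₂^m`. -/
def reedMuller (r m : ℕ) : Submodule (ZMod 2) ((Fin m → ZMod 2) → ZMod 2) :=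
  (MvPolynomial.restrictTotalDegree (Fin m) (ZMod 2) r).map (MvPolynomial.evalₗ (ZMod 2) (Fin m))

/-- The (extended) Preparata code on the coordinate set `F × 𝔽₂`, with `σ = 2 ^ s`. A word `c` is the
pair `(X, Y)` of subsets of `F` with indicators `c (·, 0)` and `c (·, 1)`; it is a codeword iff
`|X|` and `|Y|` are even, `∑_X x = ∑_Y y`, and `∑_X x^(σ+1) + (∑_X x)^(σ+1) = ∑_Y y^(σ+1)`.
Preparata's original code is the case `s = 1`. -/
def preparataOn (F : Type*) [Field F] [Fintype F] [Algebra (ZMod 2) F] (s : ℕ) :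
    Set (F × ZMod 2 → ZMod 2) :=
  {c | ∑ x, c (x, 0) = 0 ∧ ∑ y, c (y, 1) = 0 ∧
    ∑ x, c (x, 0) • x = ∑ y, c (y, 1) • y ∧
    ∑ x, c (x, 0) • x ^ (2 ^ s + 1) + (∑ x, c (x, 0) • x) ^ (2 ^ s + 1) =
      ∑ y, c (y, 1) • y ^ (2 ^ s + 1)}

/-- The Preparata code `P(m)` with its coordinates indexed by the points of `𝔽₂^m`, through a linear
identification of `𝔽₂^m` with `F × 𝔽₂`. -/
def preparata {m : ℕ} {F : Type*} [Field F] [Fintype F] [Algebra (ZMod 2) F]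
    (e : (Fin m → ZMod 2) ≃ₗ[ZMod 2] F × ZMod 2) (s : ℕ) : Set ((Fin m → ZMod 2) → ZMod 2) :=
  {c | (fun p => c (e.symm p)) ∈ preparataOn F s}

/-- `S` is the disjoint union of the cosets `t + C`, `t ∈ T`, these cosets being distinct. -/
def IsCosetDecomposition {ι : Type*} (C : Submodule (ZMod 2) (ι → ZMod 2))
    (T : Finset (ι → ZMod 2)) (S : Set (ι → ZMod 2)) : Prop :=
  (∀ v, v ∈ S ↔ ∃ t ∈ T, v - t ∈ C) ∧ ∀ t ∈ T, ∀ t' ∈ T, t - t' ∈ C → t = t'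

/-! ### Quantum codes -/

/-- The Hilbert space `(ℂ²)^{⊗ι}`, with computational basis indexed by the bit strings `ι → 𝔽₂`. -/
abbrev Qubits (ι : Type*) [Fintype ι] : Type _ := EuclideanSpace ℂ (ι → ZMod 2)

/-- The Pauli operator `⊗ᵢ σ_x^{aᵢ} σ_z^{bᵢ}`, which maps `|y⟩` to `(-1)^{b·y} |y + a⟩`. -/
def pauliOp {ι : Type*} [Fintype ι] [DecidableEq ι] (a b : ι → ZMod 2) :
    Qubits ι →ₗ[ℂ] Qubits ι where
  toFun ψ := WithLp.toLp 2 fun x => (-1 : ℂ) ^ (b ⬝ᵥ (x + a)).val * ψ (x + a)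
  map_add' := by
    intro φ ψ
    ext x
    simp [mul_add]
  map_smul' := by
    intro r ψ
    ext x
    simp [mul_left_comm]

/-- The weight of `⊗ᵢ σ_x^{aᵢ} σ_z^{bᵢ}`: the number of tensor factors different from identity. -/
def pauliWeight {ι : Type*} [Fintype ι] (a b : ι → ZMod 2) : ℕ :=
  hammingNorm fun i => (a i, b i)

/-- Membership in the Pauli group: a Pauli operator up to a phase `±1, ±i`. -/
def IsPauli {ι : Type*} [Fintype ι] [DecidableEq ι] (g : Qubits ι →ₗ[ℂ] Qubits ι) : Prop :=
  ∃ (k : ℕ) (a b : ι → ZMod 2), g = Complex.I ^ k • pauliOp a b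

/-- Stabilizer (additive) codes: the nonzero joint `+1` eigenspaces of commuting sets of elements of
the Pauli group. -/
def IsStabilizerCode {ι : Type*} [Fintype ι] [DecidableEq ι] (Q : Submodule ℂ (Qubits ι)) : Prop :=
  Q ≠ ⊥ ∧ ∃ S : Set (Qubits ι →ₗ[ℂ] Qubits ι), (∀ g ∈ S, IsPauli g) ∧
    (∀ g ∈ S, ∀ h ∈ S, Commute g h) ∧ ∀ ψ, ψ ∈ Q ↔ ∀ g ∈ S, g ψ = ψ

/-- The code `Q` detects the error `E`: the compression of `E` to `Q` is a scalar. -/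
def Detects {ι : Type*} [Fintype ι] [DecidableEq ι] (Q : Submodule ℂ (Qubits ι))
    (E : Qubits ι →ₗ[ℂ] Qubits ι) : Prop :=
  ∃ c : ℂ, ∀ φ ∈ Q, ∀ ψ ∈ Q, inner ℂ φ (E ψ) = c * inner ℂ φ ψ

/-- The weights of the Pauli errors that `Q` does not detect; for a code of dimension greater
than one, the least of them is its minimum distance. -/
def undetectedWeights {ι : Type*} [Fintype ι] [DecidableEq ι] (Q : Submodule ℂ (Qubits ι)) :
    Set ℕ :=
  {w | ∃ a b : ι → ZMod 2, pauliWeight a b = w ∧ ¬ Detects Q (pauliOp a b)}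

/-- `Q` is an `((n, K, d))` quantum code: `n` qubits, dimension `K`, minimum distance exactly `d`. -/
def IsQuantumCode {ι : Type*} [Fintype ι] [DecidableEq ι] (Q : Submodule ℂ (Qubits ι))
    (n K d : ℕ) : Prop :=
  Fintype.card ι = n ∧ Module.finrank ℂ Q = K ∧ IsLeast (undetectedWeights Q) d

/-- The CSS code of `C₁` and `C₂` (where `C₂^⊥ ⊆ C₁`): the joint `+1` eigenspace of the operators
`X^a`, `a ∈ C₂^⊥`, and `Z^b`, `b ∈ C₁^⊥`. -/
def cssCode {ι : Type*} [Fintype ι] [DecidableEq ι] (C₁ C₂ : Submodule (ZMod 2) (ι → ZMod 2)) :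
    Submodule ℂ (Qubits ι) where
  carrier := {ψ | (∀ a ∈ dualCode C₂, pauliOp a 0 ψ = ψ) ∧ ∀ b ∈ dualCode C₁, pauliOp 0 b ψ = ψ}
  add_mem' := by
    intro φ ψ hφ hψ
    refine ⟨fun a ha => ?_, fun b hb => ?_⟩
    · rw [map_add, hφ.1 a ha, hψ.1 a ha]
    · rw [map_add, hφ.2 b hb, hψ.2 b hb]
  zero_mem' := ⟨fun a _ => map_zero _, fun b _ => map_zero _⟩
  smul_mem' := by
    intro r ψ hψ
    refine ⟨fun a ha => ?_, fun b hb => ?_⟩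
    · rw [map_smul, hψ.1 a ha]
    · rw [map_smul, hψ.2 b hb]

/-- The union code: the span of the translates `X^{t₁} Z^{t₂} C₀`, `(t₁ | t₂) ∈ T`. -/
def unionCode {ι : Type*} [Fintype ι] [DecidableEq ι] (C₀ : Submodule ℂ (Qubits ι))
    (T : Set ((ι → ZMod 2) × (ι → ZMod 2))) : Submodule ℂ (Qubits ι) :=
  ⨆ t ∈ T, C₀.map (pauliOp t.1 t.2)

/-- The CSS-like union code from the CSS code of `C₁, C₂` and the translations
`(t₁ | t₂)`, `t₁ ∈ T₁`, `t₂ ∈ T₂`. -/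
def cssUnionCode {ι : Type*} [Fintype ι] [DecidableEq ι]
    (C₁ C₂ : Submodule (ZMod 2) (ι → ZMod 2)) (T₁ T₂ : Finset (ι → ZMod 2)) :
    Submodule ℂ (Qubits ι) :=
  unionCode (cssCode C₁ C₂) {t | t.1 ∈ T₁ ∧ t.2 ∈ T₂}

/-- `D` is a linear complement of `C` in `C'`, and `A` has no nonzero fixed point: the data of an
enlargement of the CSS code of `C` by `C'`. -/
def IsEnlargementData {ι : Type*} (C C' D : Submodule (ZMod 2) (ι → ZMod 2))
    (A : D ≃ₗ[ZMod 2] D) : Prop :=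
  C ⊓ D = ⊥ ∧ C ⊔ D = C' ∧ ∀ v : D, A v = v → v = 0

/-- The enlarged CSS code: the union code from the CSS code of `C` (twice) and the translations
`(v | A v)`, `v ∈ D`. -/
def enlargedCode {ι : Type*} [Fintype ι] [DecidableEq ι]
    (C D : Submodule (ZMod 2) (ι → ZMod 2)) (A : D ≃ₗ[ZMod 2] D) : Submodule ℂ (Qubits ι) :=
  unionCode (cssCode C C) {t | ∃ v : D, t = ((v : ι → ZMod 2), (A v : ι → ZMod 2))}

end

end UnionCode

open UnionCode

/-!
The CSS code of `R` is the joint eigenspace with all signs `+1` of a group of commuting Pauli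
operators. Translating it by `X^a Z^b` permutes the joint eigenspaces of this group, which are
labelled by the pairs `(a, b)` modulo `R × R`. Hence the union code is a sum of mutually orthogonal
eigenspaces, and errors act on it by shifting labels: it inherits the minimum distance of the
Preparata code, and if it were a stabilizer code, its set of labels would be closed under
`t - t' + t''`, making the Preparata code linear.

On the classical side, a word is a pair of binary words on `F`, constrained by their syndromes
`(∑ 1, ∑ x, ∑ x^(σ + 1))`. Adding a word of `RM(m - 3, m)` changes both syndromes by the same
`(0, 0, γ)`, since that word is orthogonal to all functions of algebraic degree at most two on
`𝔽₂^m`, and this preserves the constraints. A translation of the first half makes the Preparata code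
distance invariant. Its distance six comes from the Gold function `x ↦ x^(σ + 1)`, whose associated
bilinear map `x^σ y + x y^σ` vanishes only if `x`, `y` are linearly dependent over `𝔽₂`.

For an enlarged code the translations `(v, A v)` form a subspace, so it is again a joint eigenspace.
An undetected error `(a, b)` outside `R × R` has `a`, `b`, `a + b` nonzero in `RM(m - 2, m)`, hence
of weight at least four, and `wt(a) + wt(b) + wt(a + b) = 2 wt(a, b)` gives the bound six.
The dimension of an enlarged code is smaller than that of the union code by the factor
`2^(m choose 2 - 2 m + 2)`.
-/

namespace UnionCode

lemma zmod_two_eq_zero_or_one : ∀ z : ZMod 2, z = 0 ∨ z = 1 := by decide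

lemma zmod_two_pow_eq_self {k : ℕ} (hk : k ≠ 0) (x : ZMod 2) : x ^ k = x := by
  rcases zmod_two_eq_zero_or_one x with rfl | rfl
  · exact zero_pow hk
  · exact one_pow k

/-! ### Dual codes and the symplectic form -/

section Dual

variable {ι : Type*} [Fintype ι]

lemma mem_dualCode {C : Submodule (ZMod 2) (ι → ZMod 2)} {v : ι → ZMod 2} :
    v ∈ dualCode C ↔ ∀ c ∈ C, v ⬝ᵥ c = 0 := Iff.rfl

variable (ι) in
/-- The dot product on `𝔽₂^ι` as a bilinear form. -/
abbrev dotForm : LinearMap.BilinForm (ZMod 2) (ι → ZMod 2) :=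
  dotProductBilin (ZMod 2) (ZMod 2)

lemma dotForm_isSymm : (dotForm ι).IsSymm := ⟨fun v w => dotProduct_comm v w⟩

lemma dotForm_nondegenerate : (dotForm ι).Nondegenerate :=
  dotForm_isSymm.isRefl.nondegenerate_iff_separatingLeft.2 fun _ hv =>
    dotProduct_eq_zero _ hv

lemma dualCode_eq_orthogonal (C : Submodule (ZMod 2) (ι → ZMod 2)) :
    dualCode C = (dotForm ι).orthogonal C := by
  ext v
  exact forall₂_congr fun c _ => by rw [dotProduct_comm]; rfl

lemma finrank_dualCode (C : Submodule (ZMod 2) (ι → ZMod 2)) :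
    Module.finrank (ZMod 2) (dualCode C) = Fintype.card ι - Module.finrank (ZMod 2) C := by
  rw [dualCode_eq_orthogonal, LinearMap.BilinForm.finrank_orthogonal dotForm_nondegenerate,
    Module.finrank_fintype_fun_eq_card]

lemma finrank_le_card (C : Submodule (ZMod 2) (ι → ZMod 2)) :
    Module.finrank (ZMod 2) C ≤ Fintype.card ι :=
  C.finrank_le.trans_eq (Module.finrank_fintype_fun_eq_card _)

/-- The pairs `(a, b)` labelling the Pauli operators `X^a Z^b`. -/
abbrev PhaseSpace (ι : Type*) : Type _ := (ι → ZMod 2) × (ι → ZMod 2)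

variable (ι) in
/-- The symplectic form on phase space: two Pauli operators commute up to the sign it gives. -/
def symplecticForm : LinearMap.BilinForm (ZMod 2) (PhaseSpace ι) :=
  (dotForm ι).compl₁₂ (.fst _ _ _) (.snd _ _ _) + (dotForm ι).compl₁₂ (.snd _ _ _) (.fst _ _ _)

lemma symplecticForm_apply (p q : PhaseSpace ι) :
    symplecticForm ι p q = p.1 ⬝ᵥ q.2 + p.2 ⬝ᵥ q.1 := rfl

lemma symplecticForm_isSymm : (symplecticForm ι).IsSymm := ⟨fun p q => by
  simp only [symplecticForm_apply, dotProduct_comm p.1, dotProduct_comm p.2]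
  exact add_comm _ _⟩

lemma symplecticForm_nondegenerate : (symplecticForm ι).Nondegenerate := by
  refine symplecticForm_isSymm.isRefl.nondegenerate_iff_separatingLeft.2 fun p hp => Prod.ext ?_ ?_
  · exact dotProduct_eq_zero _ fun b => by simpa [symplecticForm_apply] using hp (0, b)
  · exact dotProduct_eq_zero _ fun a => by simpa [symplecticForm_apply] using hp (a, 0)

lemma symplecticForm_orthogonal_orthogonal (S : Submodule (ZMod 2) (PhaseSpace ι)) :
    (symplecticForm ι).orthogonal ((symplecticForm ι).orthogonal S) = S :=
  LinearMap.BilinForm.orthogonal_orthogonal symplecticForm_nondegenerate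
    symplecticForm_isSymm.isRefl S

lemma symplecticForm_orthogonal_prod_dualCode (C₁ C₂ : Submodule (ZMod 2) (ι → ZMod 2)) :
    (symplecticForm ι).orthogonal ((dualCode C₂).prod (dualCode C₁)) = C₁.prod C₂ := by
  rw [← symplecticForm_orthogonal_orthogonal (C₁.prod C₂)]
  congr 1
  ext ⟨a, b⟩
  simp only [Submodule.mem_prod, mem_dualCode, LinearMap.BilinForm.mem_orthogonal_iff,
    symplecticForm_apply, Prod.forall]
  constructor
  · rintro ⟨ha, hb⟩ c₁ c₂ ⟨h₁, h₂⟩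
    rw [dotProduct_comm c₁, dotProduct_comm c₂, ha c₂ h₂, hb c₁ h₁, add_zero]
  · intro h
    refine ⟨fun c hc => ?_, fun c hc => ?_⟩
    · simpa [dotProduct_comm] using h 0 c ⟨zero_mem _, hc⟩
    · simpa [dotProduct_comm] using h c 0 ⟨hc, zero_mem _⟩

end Dual

/-! ### Reed–Muller codes -/

section ReedMuller

variable {m r k : ℕ} {f g : (Fin m → ZMod 2) → ZMod 2}

lemma reedMuller_mono (h : r ≤ k) : reedMuller r m ≤ reedMuller k m :=
  Submodule.map_mono fun p hp => by
    rw [MvPolynomial.mem_restrictTotalDegree] at hp ⊢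
    exact hp.trans h

lemma one_mem_reedMuller : (1 : (Fin m → ZMod 2) → ZMod 2) ∈ reedMuller r m :=
  ⟨1, by simp [MvPolynomial.mem_restrictTotalDegree], by ext; simp [MvPolynomial.evalₗ_apply]⟩

lemma eval_mem_reedMuller_one (i : Fin m) : (fun x => x i) ∈ reedMuller 1 m :=
  ⟨MvPolynomial.X i, by simp [MvPolynomial.mem_restrictTotalDegree],
    by ext; simp [MvPolynomial.evalₗ_apply]⟩

lemma mul_mem_reedMuller (hf : f ∈ reedMuller r m) (hg : g ∈ reedMuller k m) :
    f * g ∈ reedMuller (r + k) m := by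
  obtain ⟨p, hp, rfl⟩ := hf
  obtain ⟨q, hq, rfl⟩ := hg
  rw [SetLike.mem_coe, MvPolynomial.mem_restrictTotalDegree] at hp hq
  refine ⟨p * q, ?_, by ext; simp [MvPolynomial.evalₗ_apply]⟩
  rw [SetLike.mem_coe, MvPolynomial.mem_restrictTotalDegree]
  exact (MvPolynomial.totalDegree_mul p q).trans (add_le_add hp hq)

lemma sum_eq_zero_of_mem_reedMuller (hr : r < m) (hf : f ∈ reedMuller r m) : ∑ x, f x = 0 := by
  obtain ⟨p, hp, rfl⟩ := hf
  rw [SetLike.mem_coe, MvPolynomial.mem_restrictTotalDegree] at hp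
  simp only [MvPolynomial.evalₗ_apply]
  refine MvPolynomial.sum_eval_eq_zero p ?_
  rw [ZMod.card, Fintype.card_fin]
  omega

lemma dotProduct_eq_zero_of_mem_reedMuller (h : r + k < m) (hf : f ∈ reedMuller r m)
    (hg : g ∈ reedMuller k m) : f ⬝ᵥ g = 0 :=
  sum_eq_zero_of_mem_reedMuller h (mul_mem_reedMuller hf hg)

/-- The square-free monomial function `x ↦ ∏_{i ∈ S} xᵢ`; these form a basis of the functions on
`𝔽₂^m`, and those with `|S| ≤ r` a basis of `RM(r, m)`. -/
def monomialFun (S : Finset (Fin m)) : (Fin m → ZMod 2) → ZMod 2 := fun x => ∏ i ∈ S, x i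

lemma evalₗ_eq_sum_monomialFun (p : MvPolynomial (Fin m) (ZMod 2)) :
    MvPolynomial.evalₗ (ZMod 2) (Fin m) p =
      ∑ d ∈ p.support, p.coeff d • monomialFun d.support := by
  ext x
  rw [MvPolynomial.evalₗ_apply, MvPolynomial.eval_eq]
  simp only [Finset.sum_apply, Pi.smul_apply, smul_eq_mul, monomialFun]
  refine Finset.sum_congr rfl fun d _ => congrArg _ (Finset.prod_congr rfl fun i hi => ?_)
  exact zmod_two_pow_eq_self (Finsupp.mem_support_iff.1 hi) _

lemma evalₗ_prod_X (S : Finset (Fin m)) :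
    MvPolynomial.evalₗ (ZMod 2) (Fin m) (∏ i ∈ S, MvPolynomial.X i) = monomialFun S := by
  ext x
  simp [MvPolynomial.evalₗ_apply, monomialFun]

lemma card_support_le_totalDegree {α R : Type*} [CommSemiring R] {p : MvPolynomial α R}
    {d : α →₀ ℕ} (hd : d ∈ p.support) : d.support.card ≤ p.totalDegree := by
  refine le_trans ?_ (MvPolynomial.le_totalDegree hd)
  rw [Finset.card_eq_sum_ones]
  exact Finset.sum_le_sum fun i hi => Nat.one_le_iff_ne_zero.2 (Finsupp.mem_support_iff.1 hi)

lemma reedMuller_eq_span (r m : ℕ) :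
    reedMuller r m =
      Submodule.span (ZMod 2)
        (Set.range fun S : {S : Finset (Fin m) // S.card ≤ r} => monomialFun S.1) := by
  apply le_antisymm
  · rintro _ ⟨p, hp, rfl⟩
    rw [SetLike.mem_coe, MvPolynomial.mem_restrictTotalDegree] at hp
    rw [evalₗ_eq_sum_monomialFun]
    refine Submodule.sum_mem _ fun d hd => Submodule.smul_mem _ _ (Submodule.subset_span ?_)
    exact ⟨⟨d.support, (card_support_le_totalDegree hd).trans hp⟩, rfl⟩
  · rw [Submodule.span_le]
    rintro _ ⟨⟨S, hS⟩, rfl⟩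
    refine ⟨∏ i ∈ S, MvPolynomial.X i, ?_, evalₗ_prod_X S⟩
    rw [SetLike.mem_coe, MvPolynomial.mem_restrictTotalDegree]
    refine (MvPolynomial.totalDegree_finsetProd _ _).trans ?_
    simpa only [MvPolynomial.totalDegree_X, Finset.sum_const, smul_eq_mul, mul_one] using hS

lemma linearIndependent_monomialFun :
    LinearIndependent (ZMod 2) (monomialFun : Finset (Fin m) → _) := by
  apply linearIndependent_of_top_le_span_of_card_eq_finrank
  · intro f _
    obtain ⟨p, -, rfl⟩ : f ∈ (MvPolynomial.restrictDegree (Fin m) (ZMod 2)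
        (Fintype.card (ZMod 2) - 1)).map (MvPolynomial.evalₗ (ZMod 2) (Fin m)) :=
      (MvPolynomial.map_restrict_dom_evalₗ (ZMod 2) (Fin m)).symm ▸ Submodule.mem_top
    rw [evalₗ_eq_sum_monomialFun]
    exact Submodule.sum_mem _ fun d _ => Submodule.smul_mem _ _ (Submodule.subset_span ⟨_, rfl⟩)
  · simp

lemma card_finset_card_le (α : Type*) [Fintype α] (r : ℕ) :
    Fintype.card {S : Finset α // S.card ≤ r} =
      ∑ i ∈ Finset.range (r + 1), (Fintype.card α).choose i := by
  classical
  rw [Fintype.card_subtype, Finset.card_eq_sum_card_fiberwise (f := Finset.card)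
    (t := Finset.range (r + 1)) fun S hS => by simpa [Nat.lt_succ_iff] using hS]
  refine Finset.sum_congr rfl fun i hi => ?_
  have hfiber : (Finset.univ.filter fun S : Finset α => S.card ≤ r).filter
      (fun S => S.card = i) = Finset.univ.powersetCard i := by
    ext S
    simp only [Finset.mem_filter, Finset.mem_univ, true_and, Finset.mem_powersetCard,
      Finset.subset_univ]
    rw [Finset.mem_range] at hi
    omega
  rw [hfiber, Finset.card_powersetCard, Finset.card_univ]

lemma finrank_reedMuller (r m : ℕ) :
    Module.finrank (ZMod 2) (reedMuller r m) = ∑ i ∈ Finset.range (r + 1), m.choose i := by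
  have hindep := linearIndependent_monomialFun.comp
    (fun S : {S : Finset (Fin m) // S.card ≤ r} => S.1) Subtype.val_injective
  rw [reedMuller_eq_span]
  exact (finrank_span_eq_card hindep).trans
    (by rw [card_finset_card_le, Fintype.card_fin])

lemma finrank_reedMuller_add_finrank_reedMuller (h : r + k + 1 = m) :
    Module.finrank (ZMod 2) (reedMuller r m) + Module.finrank (ZMod 2) (reedMuller k m) =
      2 ^ m := by
  rw [finrank_reedMuller, finrank_reedMuller, ← Nat.sum_range_choose m,
    ← Finset.sum_range_add_sum_Ico (fun i => m.choose i) (show r + 1 ≤ m + 1 by omega)]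
  congr 1
  have hreflect := Finset.sum_Ico_reflect (fun i => m.choose i) 0 (show k + 1 ≤ m + 1 by omega)
  rw [Nat.sub_zero, show m + 1 - (k + 1) = r + 1 by omega] at hreflect
  rw [Finset.range_eq_Ico, ← hreflect]
  refine Finset.sum_congr rfl fun i hi => (Nat.choose_symm ?_).symm
  rw [Finset.mem_Ico] at hi
  omega

lemma dualCode_reedMuller (h : r + k + 1 = m) : dualCode (reedMuller r m) = reedMuller k m := by
  refine (Submodule.eq_of_le_of_finrank_eq (fun g hg f hf => ?_) ?_).symm
  · exact dotProduct_eq_zero_of_mem_reedMuller (by omega) hg hf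
  · have hadd := finrank_reedMuller_add_finrank_reedMuller h
    rw [finrank_dualCode, Fintype.card_fun, ZMod.card, Fintype.card_fin]
    omega

lemma mul_mem_dualCode_reedMuller (hf : f ∈ dualCode (reedMuller (r + k) m))
    (hg : g ∈ reedMuller k m) : f * g ∈ dualCode (reedMuller r m) := by
  refine fun c hc => Eq.trans ?_ (hf _ (mul_mem_reedMuller hc hg))
  exact Finset.sum_congr rfl fun x _ => by
    rw [Pi.mul_apply, Pi.mul_apply, mul_comm (c x), mul_assoc]

lemma exists_ne_of_mem_dualCode_reedMuller (hf : f ∈ dualCode (reedMuller r m)) (hf0 : f ≠ 0) :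
    ∃ x y, x ≠ y ∧ f x ≠ 0 ∧ f y ≠ 0 := by
  obtain ⟨x, hx⟩ := Function.ne_iff.1 hf0
  by_contra! h
  have hsum : f ⬝ᵥ 1 = f x := by
    rw [dotProduct_one]
    exact Fintype.sum_eq_single x fun y hy => h x y hy.symm hx
  exact hx (hsum.symm.trans (hf 1 one_mem_reedMuller))

lemma hammingNorm_mul_add_hammingNorm_mul {ι : Type*} [Fintype ι] (f l : ι → ZMod 2) :
    hammingNorm (f * l) + hammingNorm (f * (l + 1)) = hammingNorm f := by
  have hcoord : ∀ y z : ZMod 2, (if y * z ≠ 0 then 1 else 0) +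
      (if y * (z + 1) ≠ 0 then 1 else 0) = if y ≠ 0 then 1 else 0 := by decide
  simp only [hammingNorm, Finset.card_filter, ← Finset.sum_add_distrib]
  exact Finset.sum_congr rfl fun x _ => hcoord (f x) (l x)

/-- If `f` takes nonzero values at points differing in coordinate `i`, then it vanishes identically
on neither of the hyperplanes `xᵢ = 0` and `xᵢ = 1`, and each restriction lies in the dual of the
Reed–Muller code of order one less. -/
theorem two_pow_le_hammingNorm_of_mem_dualCode_reedMuller (hf : f ∈ dualCode (reedMuller r m))
    (hf0 : f ≠ 0) : 2 ^ (r + 1) ≤ hammingNorm f := by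
  induction r generalizing f with
  | zero =>
    obtain ⟨x, y, hxy, hx, hy⟩ := exists_ne_of_mem_dualCode_reedMuller hf hf0
    exact Finset.one_lt_card.2 ⟨x, by simpa using hx, y, by simpa using hy, hxy⟩
  | succ r ih =>
    obtain ⟨x, y, hxy, hx, hy⟩ := exists_ne_of_mem_dualCode_reedMuller hf hf0
    obtain ⟨i, hi⟩ := Function.ne_iff.1 hxy
    have hrestrict {l : (Fin m → ZMod 2) → ZMod 2} (hl : l ∈ reedMuller 1 m)
        (hxy : l x ≠ 0 ∨ l y ≠ 0) : 2 ^ (r + 1) ≤ hammingNorm (f * l) := by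
      refine ih (mul_mem_dualCode_reedMuller hf hl) fun h0 => ?_
      rcases hxy with hlx | hly
      · exact mul_ne_zero hx hlx (congrFun h0 x)
      · exact mul_ne_zero hy hly (congrFun h0 y)
    have hsep : ∀ a b : ZMod 2, a ≠ b → (a ≠ 0 ∨ b ≠ 0) ∧ (a + 1 ≠ 0 ∨ b + 1 ≠ 0) := by decide
    have hcoord := eval_mem_reedMuller_one i
    have hone := hrestrict hcoord (hsep _ _ hi).1
    have hzero := hrestrict (add_mem hcoord one_mem_reedMuller) (hsep _ _ hi).2
    rw [← hammingNorm_mul_add_hammingNorm_mul f fun x => x i, pow_succ]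
    omega

/-- A function on `𝔽₂^m` with values in a vector space has algebraic degree at most `k` if all its
coordinates, in any basis, are value vectors of polynomials of degree at most `k`. -/
def HasAlgebraicDegreeLE {W : Type*} [AddCommGroup W] [Module (ZMod 2) W] (k : ℕ)
    (g : (Fin m → ZMod 2) → W) : Prop :=
  ∀ φ : Module.Dual (ZMod 2) W, (fun x => φ (g x)) ∈ reedMuller k m

section AlgebraicDegree

variable {W : Type*} [AddCommGroup W] [Module (ZMod 2) W]

lemma hasAlgebraicDegreeLE_linearMap (L : (Fin m → ZMod 2) →ₗ[ZMod 2] W) :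
    HasAlgebraicDegreeLE 1 L := by
  intro φ
  have hcoords : (fun x => φ (L x)) =
      ∑ i, φ (L (Pi.single i 1)) • fun x : Fin m → ZMod 2 => x i := by
    ext x
    conv_lhs => rw [pi_eq_sum_univ' x]
    simp only [map_sum, map_smul, Finset.sum_apply, Pi.smul_apply, smul_eq_mul, mul_comm]
  rw [hcoords]
  exact sum_mem fun i _ => Submodule.smul_mem _ _ (eval_mem_reedMuller_one i)

lemma hasAlgebraicDegreeLE_bilinear
    (B : (Fin m → ZMod 2) →ₗ[ZMod 2] (Fin m → ZMod 2) →ₗ[ZMod 2] W) :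
    HasAlgebraicDegreeLE 2 fun x => B x x := by
  intro φ
  have hcoords : (fun x => φ (B x x)) =
      ∑ i, (fun x => x i) * fun x => φ (B (Pi.single i 1) x) := by
    ext x
    have hleft : B x = ∑ i, x i • B (Pi.single i 1) := by
      conv_lhs => rw [pi_eq_sum_univ' x]
      simp only [map_sum, map_smul]
    rw [hleft]
    simp only [LinearMap.sum_apply, LinearMap.smul_apply, map_sum, map_smul, smul_eq_mul,
      Finset.sum_apply, Pi.mul_apply]
  rw [hcoords]
  exact sum_mem fun i _ => mul_mem_reedMuller (k := 1) (eval_mem_reedMuller_one i)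
    (hasAlgebraicDegreeLE_linearMap (B (Pi.single i 1)) φ)

lemma HasAlgebraicDegreeLE.sum_smul_eq_zero {g : (Fin m → ZMod 2) → W}
    (hg : HasAlgebraicDegreeLE k g) (h : r + k < m) (hf : f ∈ reedMuller r m) :
    ∑ x, f x • g x = 0 := by
  refine (Module.forall_dual_apply_eq_zero_iff (ZMod 2) _).1 fun φ => ?_
  simp only [map_sum, map_smul]
  exact dotProduct_eq_zero_of_mem_reedMuller h hf (hg φ)

end AlgebraicDegree

end ReedMuller

/-! ### Gold functions on fields of characteristic two -/

lemma exists_ne_zero_ne_one {F : Type*} [Field F] [Fintype F] {n : ℕ}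
    (hF : Fintype.card F = 2 ^ n) (hn : 2 ≤ n) : ∃ y : F, y ≠ 0 ∧ y ≠ 1 := by
  refine ENat.exists_ne_ne_of_three_le ?_ 0 1
  rw [ENat.card_eq_coe_fintype_card, hF]
  exact_mod_cast (by norm_num : 3 ≤ 2 ^ 2).trans (Nat.pow_le_pow_right two_pos hn)

section GoldFunction

variable {F : Type*} [Field F] [CharP F 2] {n s : ℕ}

lemma add_pow_two_pow_add_one (s : ℕ) (x y : F) :
    (x + y) ^ (2 ^ s + 1) =
      x ^ (2 ^ s + 1) + y ^ (2 ^ s + 1) + (x ^ 2 ^ s * y + x * y ^ 2 ^ s) := by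
  rw [pow_succ, add_pow_char_pow]
  ring

variable [Fintype F]

/-- The fixed field of `y ↦ y^(2^s)` in `𝔽_{2^n}` is `𝔽_{2^{gcd(s, n)}}`. -/
lemma eq_zero_or_one_of_pow_two_pow_eq_self (hF : Fintype.card F = 2 ^ n) (hs : s.Coprime n)
    {y : F} (hy : y ^ 2 ^ s = y) : y = 0 ∨ y = 1 := by
  have hperiod_s : Function.IsPeriodicPt (frobenius F 2) s y := by
    rw [Function.IsPeriodicPt, Function.IsFixedPt, iterate_frobenius, hy]
  have hperiod_n : Function.IsPeriodicPt (frobenius F 2) n y := by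
    rw [Function.IsPeriodicPt, Function.IsFixedPt, iterate_frobenius, ← hF, FiniteField.pow_card]
  have hfixed := hperiod_s.gcd hperiod_n
  rw [hs.gcd_eq_one, Function.IsPeriodicPt, Function.IsFixedPt, iterate_frobenius,
    pow_one] at hfixed
  have hidem : IsIdempotentElem y := (sq y).symm.trans hfixed
  exact IsIdempotentElem.iff_eq_zero_or_one.1 hidem

lemma eq_of_pow_mul_add_mul_pow_eq_zero (hF : Fintype.card F = 2 ^ n) (hs : s.Coprime n) {x y : F}
    (hx : x ≠ 0) (hy : y ≠ 0) (h : x ^ 2 ^ s * y + x * y ^ 2 ^ s = 0) : x = y := by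
  have hratio : (x / y) ^ 2 ^ s = x / y := by
    rw [div_pow, div_eq_div_iff (pow_ne_zero _ hy) hy]
    exact CharTwo.add_eq_zero.1 h
  rcases eq_zero_or_one_of_pow_two_pow_eq_self hF hs hratio with hzero | hone
  · exact absurd hzero (div_ne_zero hx hy)
  · exact (div_eq_one_iff_eq hy).1 hone

lemma pow_two_pow_two_mul_ne_self (hF : Fintype.card F = 2 ^ n) (hn : Odd n) (hs : s.Coprime n)
    {y : F} (hy0 : y ≠ 0) (hy1 : y ≠ 1) : y ^ 2 ^ (2 * s) ≠ y := fun h =>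
  (eq_zero_or_one_of_pow_two_pow_eq_self hF
    (Nat.Coprime.mul_left (Nat.coprime_two_left.2 hn) hs) h).elim hy0 hy1

lemma pow_two_pow_ne_add_one (hF : Fintype.card F = 2 ^ n) (hn : Odd n) (hs : s.Coprime n)
    (y : F) : y ^ 2 ^ s ≠ y + 1 := by
  intro h
  have hy0 : y ≠ 0 := by
    rintro rfl
    rw [zero_pow (by positivity), zero_add] at h
    exact zero_ne_one h
  have hy1 : y ≠ 1 := by
    rintro rfl
    rw [one_pow, CharTwo.add_self_eq_zero] at h
    exact one_ne_zero h
  refine pow_two_pow_two_mul_ne_self hF hn hs hy0 hy1 ?_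
  rw [two_mul, pow_add, pow_mul, h, add_pow_char_pow, h, one_pow, add_assoc,
    CharTwo.add_self_eq_zero, add_zero]

/-- With `x = 1` the hypothesis gives `μ (y^σ) = μ y`, so `μ` kills every
`x^σ y + (x y^σ)^σ = x^σ (y + y^(σ²))`, and `y ≠ y^(σ²)` for any `y ∉ {0, 1}`. -/
lemma eq_zero_of_map_pow_mul_add_mul_pow {M : Type*} [AddGroup M] (hF : Fintype.card F = 2 ^ n)
    (hn : Odd n) (hn2 : 2 ≤ n) (hs : s.Coprime n) (μ : F →+ M)
    (h : ∀ x y, μ (x ^ 2 ^ s * y + x * y ^ 2 ^ s) = 0) : μ = 0 := by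
  obtain ⟨y, hy0, hy1⟩ := exists_ne_zero_ne_one hF hn2
  have hfactor : y - y ^ 2 ^ (2 * s) ≠ 0 :=
    sub_ne_zero.2 (pow_two_pow_two_mul_ne_self hF hn hs hy0 hy1).symm
  have hfrob (z : F) : μ (z ^ 2 ^ s) = μ z := by
    have hone := h 1 z
    rw [one_pow, one_mul, one_mul, ← CharTwo.sub_eq_add, map_sub] at hone
    exact (sub_eq_zero.1 hone).symm
  ext z
  obtain ⟨x, hx⟩ := (iterateFrobeniusEquiv F 2 s).surjective (z / (y - y ^ 2 ^ (2 * s)))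
  rw [iterateFrobeniusEquiv_def] at hx
  calc μ z = μ (x ^ 2 ^ s * y - (x * y ^ 2 ^ s) ^ 2 ^ s) := by
        rw [mul_pow, ← pow_mul, ← pow_add, ← two_mul, ← mul_sub, hx, div_mul_cancel₀ z hfactor]
    _ = μ (x ^ 2 ^ s * y + x * y ^ 2 ^ s) := by
        rw [map_sub, hfrob, ← map_sub, CharTwo.sub_eq_add]
    _ = 0 := h x y

end GoldFunction

/-! ### The syndrome of a binary word on a field -/

section Syndrome

lemma charP_two_of_algebra (F : Type*) [Field F] [Algebra (ZMod 2) F] : CharP F 2 :=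
  charP_of_injective_algebraMap (algebraMap (ZMod 2) F).injective 2

variable {F : Type*} [Field F] [Fintype F] [Algebra (ZMod 2) F] {n s : ℕ}

variable (F) in
/-- The syndrome `u ↦ (∑ u(x), ∑ u(x) x, ∑ u(x) x^(2^s + 1))` of a binary word on `F`. Its kernel
is the extended cyclic code with zeros `1` and `2^s + 1`, the double-error-correcting BCH code if
`s = 1`. -/
def syndrome (s : ℕ) : (F → ZMod 2) →ₗ[ZMod 2] ZMod 2 × F × F :=
  Fintype.linearCombination (ZMod 2) fun x : F => ((1 : ZMod 2), x, x ^ (2 ^ s + 1))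

lemma syndrome_apply (s : ℕ) (u : F → ZMod 2) :
    syndrome F s u = (∑ x, u x, ∑ x, u x • x, ∑ x, u x • x ^ (2 ^ s + 1)) := by
  simp only [syndrome, Fintype.linearCombination_apply, Prod.smul_mk, smul_eq_mul, mul_one]
  ext <;> simp only [Prod.fst_sum, Prod.snd_sum]

lemma syndrome_surjective (hF : Fintype.card F = 2 ^ n) (hn : Odd n) (hn2 : 2 ≤ n)
    (hs : s.Coprime n) : Function.Surjective (syndrome F s) := by
  classical
  have := charP_two_of_algebra F
  rw [← LinearMap.range_eq_top]
  by_contra hne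
  obtain ⟨f, hf0, hf⟩ := Submodule.exists_le_ker_of_lt_top _ (lt_top_iff_ne_top.2 hne)
  have hpoint (x : F) : f (1, x, x ^ (2 ^ s + 1)) = 0 :=
    hf ⟨Pi.single x 1, by simp [syndrome, Fintype.linearCombination_apply_single]⟩
  have hconst : f (1, 0, 0) = 0 := by simpa using hpoint 0
  have hgraph (x : F) : f (0, x, x ^ (2 ^ s + 1)) = 0 := by
    have hdiff : ((0 : ZMod 2), x, x ^ (2 ^ s + 1)) = (1, x, x ^ (2 ^ s + 1)) - (1, 0, 0) := by simp
    rw [hdiff, map_sub, hpoint, hconst, sub_zero]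
  have hlast : f ∘ₗ .inr _ _ _ ∘ₗ .inr _ _ _ = 0 := by
    refine LinearMap.toAddMonoidHom_injective
      (eq_zero_of_map_pow_mul_add_mul_pow hF hn hn2 hs _ fun x y => ?_)
    have hdiff : ((0 : ZMod 2), (0 : F), x ^ 2 ^ s * y + x * y ^ 2 ^ s) =
        (0, x + y, (x + y) ^ (2 ^ s + 1)) - (0, x, x ^ (2 ^ s + 1)) - (0, y, y ^ (2 ^ s + 1)) := by
      rw [add_pow_two_pow_add_one]
      refine Prod.ext (by simp) (Prod.ext (by simp) ?_)
      simp only [Prod.snd_sub]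
      ring
    change f (0, 0, x ^ 2 ^ s * y + x * y ^ 2 ^ s) = 0
    rw [hdiff, map_sub, map_sub, hgraph, hgraph, hgraph, sub_zero, sub_zero]
  have hlast_apply (z : F) : f (0, 0, z) = 0 := LinearMap.congr_fun hlast z
  refine hf0 (LinearMap.ext fun ⟨a, y, z⟩ => ?_)
  have hdecomp : (a, y, z) =
      a • (1, 0, 0) + (0, y, y ^ (2 ^ s + 1)) + (0, 0, z - y ^ (2 ^ s + 1)) := by simp
  rw [hdecomp, map_add, map_add, map_smul, hconst, hgraph, hlast_apply, smul_zero, add_zero,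
    add_zero, LinearMap.zero_apply]

lemma sum_smul_pow_two_pow (u : F → ZMod 2) (s : ℕ) :
    ∑ x, u x • x ^ 2 ^ s = (∑ x, u x • x) ^ 2 ^ s := by
  have := charP_two_of_algebra F
  rw [sum_pow_char_pow]
  refine Finset.sum_congr rfl fun x _ => ?_
  rw [Algebra.smul_def, Algebra.smul_def, mul_pow, ← map_pow,
    zmod_two_pow_eq_self (by positivity)]

lemma sum_comp_add_right_smul {G R M : Type*} [AddGroup G] [Fintype G] [AddCommMonoid M] [SMul R M]
    (v : G → R) (g : G → M) (a : G) : ∑ x, v (x - a) • g x = ∑ x, v x • g (x + a) := by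
  rw [← Equiv.sum_comp (Equiv.addRight a)]
  simp only [Equiv.coe_addRight, add_sub_cancel_right]

lemma syndrome_comp_sub_right {v : F → ZMod 2} {b c : F} (hv : syndrome F s v = (0, b, c)) (a : F) :
    syndrome F s (fun x => v (x - a)) = (0, b, c + (b ^ 2 ^ s * a + b * a ^ 2 ^ s)) := by
  have := charP_two_of_algebra F
  rw [syndrome_apply, Prod.mk.injEq, Prod.mk.injEq] at hv
  obtain ⟨hparity, hlin, hpow⟩ := hv
  have hconst (z : F) : ∑ x, v x • z = 0 := by rw [← Finset.sum_smul, hparity, zero_smul]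
  rw [syndrome_apply]
  refine Prod.ext ?_ (Prod.ext ?_ ?_)
  · exact (Equiv.sum_comp (Equiv.subRight a) v).trans hparity
  · change ∑ x, v (x - a) • x = b
    rw [sum_comp_add_right_smul v fun x => x]
    simp only [smul_add, Finset.sum_add_distrib, hlin, hconst, add_zero]
  · change ∑ x, v (x - a) • x ^ (2 ^ s + 1) = _
    rw [sum_comp_add_right_smul v fun x => x ^ (2 ^ s + 1)]
    simp only [add_pow_two_pow_add_one, smul_add, Finset.sum_add_distrib, hpow, hconst, add_zero]
    simp only [← smul_mul_assoc, ← Finset.sum_mul, sum_smul_pow_two_pow, hlin]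

end Syndrome

/-! ### Minimum distances -/

section MinimumDistance

lemma sum_smul_eq_sum_support {α M : Type*} [Fintype α] [AddCommGroup M] [Module (ZMod 2) M]
    (u : α → ZMod 2) (g : α → M) : ∑ x, u x • g x = ∑ x with u x ≠ 0, g x := by
  rw [Finset.sum_filter]
  refine Finset.sum_congr rfl fun x _ => ?_
  rcases zmod_two_eq_zero_or_one (u x) with h | h <;> simp [h]

variable {F : Type*} [Field F]

lemma sum_ne_zero_of_card_eq_two [CharP F 2] {U : Finset F} (hU : U.card = 2) :
    ∑ x ∈ U, x ≠ 0 := by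
  classical
  obtain ⟨a, b, hab, rfl⟩ := Finset.card_eq_two.1 hU
  rw [Finset.sum_pair hab]
  exact fun h => hab (CharTwo.add_eq_zero.1 h)

variable [Fintype F] {n s : ℕ}

/-- If the points are `a, a + x, a + y, a + x + y`, then `∑ z^(σ+1) = x^σ y + x y^σ`. -/
lemma sum_pow_ne_zero_of_card_eq_four [CharP F 2] (hF : Fintype.card F = 2 ^ n) (hs : s.Coprime n)
    {U : Finset F} (hU : U.card = 4) (hsum : ∑ x ∈ U, x = 0) :
    ∑ x ∈ U, x ^ (2 ^ s + 1) ≠ 0 := by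
  classical
  obtain ⟨a, T, haT, rfl, hT⟩ := Finset.card_eq_succ.1 hU
  obtain ⟨b, c, d, hbc, hbd, hcd, rfl⟩ := Finset.card_eq_three.1 hT
  rw [Finset.sum_insert haT, Finset.sum_insert (by simp [hbc, hbd]), Finset.sum_pair hcd] at hsum ⊢
  simp only [Finset.mem_insert, Finset.mem_singleton, not_or] at haT
  obtain ⟨hab, hac, -⟩ := haT
  have htwo : (2 : F) = 0 := CharTwo.two_eq_zero
  obtain ⟨x, rfl⟩ : ∃ x, b = a + x := ⟨b - a, by ring⟩
  obtain ⟨y, rfl⟩ : ∃ y, c = a + y := ⟨c - a, by ring⟩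
  obtain rfl : d = a + (x + y) := by linear_combination hsum - (2 * a + x + y) * htwo
  intro hpow
  refine hbc (congrArg _ (eq_of_pow_mul_add_mul_pow_eq_zero hF hs
    (left_ne_add.1 hab) (left_ne_add.1 hac) ?_))
  simp only [add_pow_two_pow_add_one, add_pow_char_pow] at hpow
  linear_combination hpow - (2 * a ^ (2 ^ s + 1) + x ^ (2 ^ s + 1) + y ^ (2 ^ s + 1)
    + a ^ 2 ^ s * x + a * x ^ 2 ^ s + a ^ 2 ^ s * y + a * y ^ 2 ^ s) * htwo

/-- If `U = {a, a + x}` and `V = {a + z, a + z + x}`, then equality would give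
`(z / x)^σ = z / x + 1`. -/
lemma sum_pow_add_pow_ne_of_card_eq_two [CharP F 2] (hF : Fintype.card F = 2 ^ n) (hn : Odd n)
    (hs : s.Coprime n) {U V : Finset F} (hU : U.card = 2) (hV : V.card = 2)
    (hsum : ∑ x ∈ V, x = ∑ x ∈ U, x) :
    ∑ x ∈ V, x ^ (2 ^ s + 1) ≠ ∑ x ∈ U, x ^ (2 ^ s + 1) + (∑ x ∈ U, x) ^ (2 ^ s + 1) := by
  classical
  obtain ⟨a, b, hab, rfl⟩ := Finset.card_eq_two.1 hU
  obtain ⟨c, d, hcd, rfl⟩ := Finset.card_eq_two.1 hV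
  simp only [Finset.sum_pair hab, Finset.sum_pair hcd] at hsum ⊢
  have htwo : (2 : F) = 0 := CharTwo.two_eq_zero
  obtain ⟨x, rfl⟩ : ∃ x, b = a + x := ⟨b - a, by ring⟩
  obtain ⟨z, rfl⟩ : ∃ z, c = a + z := ⟨c - a, by ring⟩
  obtain rfl : d = a + z + x := by linear_combination hsum - z * htwo
  have hx : x ≠ 0 := left_ne_add.1 hab
  have haax : a + (a + x) = x := by linear_combination a * htwo
  rw [haax]
  intro hpow
  refine pow_two_pow_ne_add_one hF hn hs (z / x) ?_
  rw [div_pow, div_add_one hx, div_eq_div_iff (pow_ne_zero _ hx) hx]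
  simp only [add_pow_two_pow_add_one, add_pow_char_pow] at hpow
  linear_combination hpow -
    (z * x ^ 2 ^ s + z ^ (2 ^ s + 1) + a ^ 2 ^ s * z + a * z ^ 2 ^ s) * htwo

variable [Algebra (ZMod 2) F]

open Classical in
lemma syndrome_eq_sum_support (s : ℕ) (u : F → ZMod 2) :
    syndrome F s u = ((hammingNorm u : ZMod 2), ∑ x with u x ≠ 0, x,
      ∑ x with u x ≠ 0, x ^ (2 ^ s + 1)) := by
  rw [syndrome_apply, sum_smul_eq_sum_support u fun x => x, sum_smul_eq_sum_support]
  have hparity := sum_smul_eq_sum_support u fun _ => (1 : ZMod 2)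
  simp only [smul_eq_mul, mul_one, Finset.sum_const, nsmul_eq_mul] at hparity
  rw [hparity, hammingNorm]

lemma even_hammingNorm_of_syndrome_fst_eq_zero {u : F → ZMod 2} (h : (syndrome F s u).1 = 0) :
    Even (hammingNorm u) := by
  classical
  rw [syndrome_eq_sum_support] at h
  exact ZMod.natCast_eq_zero_iff_even.1 h

lemma six_le_hammingNorm_of_syndrome_eq_zero (hF : Fintype.card F = 2 ^ n) (hs : s.Coprime n)
    {u : F → ZMod 2} (h : syndrome F s u = 0) (hu : u ≠ 0) : 6 ≤ hammingNorm u := by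
  classical
  have := charP_two_of_algebra F
  obtain ⟨k, hk⟩ := even_hammingNorm_of_syndrome_fst_eq_zero (congrArg Prod.fst h)
  rw [syndrome_eq_sum_support, Prod.mk_eq_zero, Prod.mk_eq_zero] at h
  have hzero : hammingNorm u ≠ 0 := hammingNorm_ne_zero_iff.2 hu
  have htwo : hammingNorm u ≠ 2 := fun hcard => sum_ne_zero_of_card_eq_two hcard h.2.1
  have hfour : hammingNorm u ≠ 4 := fun hcard =>
    sum_pow_ne_zero_of_card_eq_four hF hs hcard h.2.1 h.2.2
  omega

lemma two_mul_mul_self_lt_choose_three {q : ℕ} (hq : 15 ≤ q) : 2 * (q * q) < q.choose 3 := by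
  obtain ⟨k, rfl⟩ := Nat.exists_eq_add_of_le' hq
  have hchoose : 6 * (k + 15).choose 3 = (k + 13) * ((k + 14) * (k + 15)) := by
    have hdesc := Nat.descFactorial_eq_factorial_mul_choose (k + 15) 3
    simpa [Nat.descFactorial_succ, Nat.factorial] using hdesc.symm
  nlinarith

lemma hammingNorm_indicator_one {α : Type*} [Fintype α] (A : Finset α) :
    hammingNorm ((A : Set α).indicator (1 : α → ZMod 2)) = A.card := by
  classical
  rw [hammingNorm]
  congr 1
  ext x
  simp

/-- There are more triples in `F` than syndromes. -/
lemma exists_syndrome_eq_zero_hammingNorm_eq_six (hF : Fintype.card F = 2 ^ n) (hn : 5 ≤ n)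
    (hs : s.Coprime n) : ∃ u : F → ZMod 2, syndrome F s u = 0 ∧ hammingNorm u = 6 := by
  classical
  have hcard : (Finset.univ : Finset (ZMod 2 × F × F)).card <
      (Finset.powersetCard 3 (Finset.univ : Finset F)).card := by
    rw [Finset.card_powersetCard, Finset.card_univ, Finset.card_univ, Fintype.card_prod,
      Fintype.card_prod, ZMod.card]
    refine two_mul_mul_self_lt_choose_three ?_
    rw [hF]
    exact (by norm_num : 15 ≤ 2 ^ 5).trans (Nat.pow_le_pow_right two_pos hn)
  let ind (A : Finset F) : F → ZMod 2 := (A : Set F).indicator 1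
  obtain ⟨A, hA, B, hB, hAB, hsyndrome⟩ := Finset.exists_ne_map_eq_of_card_lt_of_maps_to hcard
    (f := fun A => syndrome F s (ind A)) fun _ _ => Finset.mem_univ _
  rw [Finset.mem_powersetCard_univ] at hA hB
  have hzero : syndrome F s (ind A - ind B) = 0 := by rw [map_sub, hsyndrome, sub_self]
  refine ⟨ind A - ind B, hzero, le_antisymm ?_
    (six_le_hammingNorm_of_syndrome_eq_zero hF hs hzero (sub_ne_zero.2 fun h => hAB ?_))⟩
  · have htriangle := hammingDist_triangle (ind B) 0 (ind A)
    rw [hammingDist_zero_right, hammingDist_zero_left, hammingNorm_indicator_one,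
      hammingNorm_indicator_one, hA, hB, hammingDist_eq_hammingNorm, neg_add_eq_sub] at htriangle
    exact htriangle
  · exact Finset.coe_injective (Set.indicator_one_inj _ h)

end MinimumDistance

/-! ### The Preparata code -/

section PreparataPairs

variable {F : Type*} [Field F] [Fintype F] [Algebra (ZMod 2) F] {n s : ℕ} {u w u' w' : F → ZMod 2}

/-- The defining equations of the Preparata code for the two halves of a word. -/
def IsPreparataPair (s : ℕ) (u w : F → ZMod 2) : Prop :=
  ∃ b c, syndrome F s u = (0, b, c) ∧ syndrome F s w = (0, b, c + b ^ (2 ^ s + 1))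

lemma isPreparataPair_zero_left (hw : syndrome F s w = 0) : IsPreparataPair s 0 w :=
  ⟨0, 0, map_zero _, by rw [hw, zero_pow (by positivity), add_zero]; rfl⟩

lemma IsPreparataPair.six_le_hammingNorm (hF : Fintype.card F = 2 ^ n) (hn : Odd n)
    (hs : s.Coprime n) (h : IsPreparataPair s u w) (hne : ¬ (u = 0 ∧ w = 0)) :
    6 ≤ hammingNorm u + hammingNorm w := by
  classical
  have := charP_two_of_algebra F
  obtain ⟨b, c, hu, hw⟩ := h
  rcases eq_or_ne u 0 with rfl | hu0
  · rw [map_zero] at hu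
    obtain ⟨rfl, rfl⟩ : b = 0 ∧ c = 0 := by simpa using hu.symm
    rw [zero_pow (by positivity), add_zero] at hw
    exact (six_le_hammingNorm_of_syndrome_eq_zero hF hs hw fun hw0 => hne ⟨rfl, hw0⟩).trans
      (Nat.le_add_left _ _)
  rcases eq_or_ne w 0 with rfl | hw0
  · rw [map_zero] at hw
    obtain ⟨rfl, hc⟩ : b = 0 ∧ c + b ^ (2 ^ s + 1) = 0 := by simpa using hw.symm
    rw [zero_pow (by positivity), add_zero] at hc
    rw [hc] at hu
    exact (six_le_hammingNorm_of_syndrome_eq_zero hF hs hu hu0).trans (Nat.le_add_right _ _)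
  obtain ⟨i, hi⟩ := even_hammingNorm_of_syndrome_fst_eq_zero (congrArg Prod.fst hu)
  obtain ⟨j, hj⟩ := even_hammingNorm_of_syndrome_fst_eq_zero (congrArg Prod.fst hw)
  rw [← hammingNorm_ne_zero_iff] at hu0 hw0
  by_contra hlt
  rw [syndrome_eq_sum_support, Prod.mk.injEq, Prod.mk.injEq] at hu hw
  obtain ⟨-, rfl, rfl⟩ := hu
  exact sum_pow_add_pow_ne_of_card_eq_two hF hn hs (show hammingNorm u = 2 by omega)
    (show hammingNorm w = 2 by omega) hw.2.1 hw.2.2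

/-- The Preparata code is not linear, but it is distance invariant thanks to this translation. -/
lemma IsPreparataPair.exists_sub_comp_sub (h : IsPreparataPair s u w)
    (h' : IsPreparataPair s u' w') :
    ∃ a, IsPreparataPair s (fun x => (u - u') (x - a)) (w - w') := by
  have := charP_two_of_algebra F
  have htwo : (2 : F) = 0 := CharTwo.two_eq_zero
  obtain ⟨b, c, hu, hw⟩ := h
  obtain ⟨b', c', hu', hw'⟩ := h'
  have hsub : syndrome F s (u - u') = (0, b + b', c - c') := by
    rw [map_sub, hu, hu', ← CharTwo.sub_eq_add]
    simp
  refine ⟨b, _, _, syndrome_comp_sub_right hsub b, ?_⟩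
  rw [map_sub, hw, hw']
  refine Prod.ext (by simp) (Prod.ext (CharTwo.sub_eq_add _ _) ?_)
  change _ - _ = _
  rw [add_pow_two_pow_add_one, add_pow_char_pow]
  linear_combination
    -(b ^ (2 ^ s + 1) + b' ^ (2 ^ s + 1) + b ^ 2 ^ s * b' + b * b' ^ 2 ^ s) * htwo

lemma hammingNorm_comp_equiv {α β : Type*} [Fintype α] [Fintype β] (v : β → ZMod 2) (σ : α ≃ β) :
    hammingNorm (v ∘ σ) = hammingNorm v :=
  Finset.card_equiv σ (by simp)

lemma IsPreparataPair.six_le_hammingDist (hF : Fintype.card F = 2 ^ n) (hn : Odd n)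
    (hs : s.Coprime n) (h : IsPreparataPair s u w) (h' : IsPreparataPair s u' w')
    (hne : ¬ (u = u' ∧ w = w')) : 6 ≤ hammingDist u u' + hammingDist w w' := by
  obtain ⟨a, hpair⟩ := h'.exists_sub_comp_sub h
  have hnorm : hammingNorm (fun x => (u' - u) (x - a)) = hammingDist u u' := by
    rw [hammingDist_eq_hammingNorm, neg_add_eq_sub]
    exact hammingNorm_comp_equiv _ (Equiv.subRight a)
  rw [← hnorm, hammingDist_eq_hammingNorm w, neg_add_eq_sub]
  refine hpair.six_le_hammingNorm hF hn hs fun ⟨hu, hw⟩ => hne ⟨?_, (sub_eq_zero.1 hw).symm⟩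
  rw [← hammingDist_eq_zero, ← hnorm, hu]
  exact hammingNorm_zero

lemma exists_isPreparataPair_add_not (hF : Fintype.card F = 2 ^ n) (hn : Odd n) (hn2 : 2 ≤ n)
    (hs : s.Coprime n) : ∃ u w u' w' : F → ZMod 2,
      IsPreparataPair s u w ∧ IsPreparataPair s u' w' ∧ ¬ IsPreparataPair s (u + u') (w + w') := by
  have := charP_two_of_algebra F
  obtain ⟨y, hy0, hy1⟩ := exists_ne_zero_ne_one hF hn2
  have hsurj := syndrome_surjective hF hn hn2 hs
  have hpair (b : F) : ∃ u w : F → ZMod 2,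
      syndrome F s u = (0, b, 0) ∧ syndrome F s w = (0, b, 0 + b ^ (2 ^ s + 1)) :=
    let ⟨u, hu⟩ := hsurj (0, b, 0)
    let ⟨w, hw⟩ := hsurj (0, b, 0 + b ^ (2 ^ s + 1))
    ⟨u, w, hu, hw⟩
  obtain ⟨u, w, hu, hw⟩ := hpair y
  obtain ⟨u', w', hu', hw'⟩ := hpair 1
  refine ⟨u, w, u', w', ⟨_, _, hu, hw⟩, ⟨_, _, hu', hw'⟩, fun ⟨b, c, hadd, hadd'⟩ => hy1 ?_⟩
  rw [map_add, hu, hu'] at hadd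
  rw [map_add, hw, hw'] at hadd'
  obtain ⟨rfl, rfl⟩ : y + 1 = b ∧ 0 = c := by simpa using hadd
  refine eq_of_pow_mul_add_mul_pow_eq_zero hF hs hy0 one_ne_zero ?_
  have hpow : y ^ (2 ^ s + 1) + 1 = (y + 1) ^ (2 ^ s + 1) := by simpa using hadd'
  rw [add_pow_two_pow_add_one] at hpow
  linear_combination -hpow

end PreparataPairs

section Preparata

variable {m : ℕ} {F : Type*} [Field F] [Algebra (ZMod 2) F]

/-- The two halves of a word on `𝔽₂^m`, identified with `F × 𝔽₂`. -/
def halves (e : (Fin m → ZMod 2) ≃ₗ[ZMod 2] F × ZMod 2) :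
    ((Fin m → ZMod 2) → ZMod 2) ≃ₗ[ZMod 2] (F → ZMod 2) × (F → ZMod 2) where
  toFun c := (fun x => c (e.symm (x, 0)), fun x => c (e.symm (x, 1)))
  map_add' _ _ := rfl
  map_smul' _ _ := rfl
  invFun p := fun v => if (e v).2 = 0 then p.1 (e v).1 else p.2 (e v).1
  left_inv c := by
    ext v
    obtain ⟨⟨x, i⟩, rfl⟩ := e.symm.surjective v
    rcases zmod_two_eq_zero_or_one i with rfl | rfl <;> simp
  right_inv p := by ext x <;> simp

variable [Fintype F] {e : (Fin m → ZMod 2) ≃ₗ[ZMod 2] F × ZMod 2} {n r s : ℕ}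
  {c c' f : (Fin m → ZMod 2) → ZMod 2}

lemma sum_eq_sum_halves {M : Type*} [AddCommMonoid M]
    (e : (Fin m → ZMod 2) ≃ₗ[ZMod 2] F × ZMod 2) (g : (Fin m → ZMod 2) → M) :
    ∑ p, g p = ∑ x, g (e.symm (x, 0)) + ∑ x, g (e.symm (x, 1)) := by
  rw [← Equiv.sum_comp e.symm.toEquiv g, Fintype.sum_prod_type_right]
  exact Fin.sum_univ_two fun i : ZMod 2 => ∑ x, g (e.symm (x, i))

lemma hammingNorm_eq_add_halves (e : (Fin m → ZMod 2) ≃ₗ[ZMod 2] F × ZMod 2)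
    (c : (Fin m → ZMod 2) → ZMod 2) :
    hammingNorm c = hammingNorm (halves e c).1 + hammingNorm (halves e c).2 := by
  simp only [hammingNorm, Finset.card_filter]
  exact sum_eq_sum_halves e _

lemma mem_preparata_iff :
    c ∈ preparata e s ↔ IsPreparataPair s (halves e c).1 (halves e c).2 := by
  constructor
  · rintro ⟨hX, hY, hlin, hpow⟩
    exact ⟨_, _, (syndrome_apply s _).trans (Prod.ext hX rfl),
      (syndrome_apply s _).trans (Prod.ext hY (Prod.ext hlin.symm hpow.symm))⟩
  · rintro ⟨a, b, hu, hw⟩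
    rw [syndrome_apply, Prod.mk.injEq, Prod.mk.injEq] at hu hw
    obtain ⟨hX, rfl, rfl⟩ := hu
    exact ⟨hX, hw.1, hw.2.1.symm, hw.2.2.symm⟩

lemma zero_mem_preparata (e : (Fin m → ZMod 2) ≃ₗ[ZMod 2] F × ZMod 2) (s : ℕ) :
    0 ∈ preparata e s :=
  mem_preparata_iff.2 (isPreparataPair_zero_left (map_zero _))

theorem pairwise_six_le_hammingDist_preparata (hF : Fintype.card F = 2 ^ n) (hn : Odd n)
    (hs : s.Coprime n) (e : (Fin m → ZMod 2) ≃ₗ[ZMod 2] F × ZMod 2) :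
    (preparata e s).Pairwise fun c c' => 6 ≤ hammingDist c c' := by
  intro c hc c' hc' hne
  rw [hammingDist_eq_hammingNorm, hammingNorm_eq_add_halves e, map_add, map_neg, Prod.fst_add,
    Prod.snd_add, Prod.fst_neg, Prod.snd_neg, ← hammingDist_eq_hammingNorm,
    ← hammingDist_eq_hammingNorm]
  exact (mem_preparata_iff.1 hc).six_le_hammingDist hF hn hs (mem_preparata_iff.1 hc')
    fun h => hne ((halves e).injective (Prod.ext h.1 h.2))

lemma exists_mem_preparata_hammingNorm_eq_six (hF : Fintype.card F = 2 ^ n) (hn : 5 ≤ n)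
    (hs : s.Coprime n) (e : (Fin m → ZMod 2) ≃ₗ[ZMod 2] F × ZMod 2) :
    ∃ c ∈ preparata e s, hammingNorm c = 6 := by
  obtain ⟨w, hw, hnorm⟩ := exists_syndrome_eq_zero_hammingNorm_eq_six hF hn hs
  refine ⟨(halves e).symm (0, w), ?_, ?_⟩
  · rw [mem_preparata_iff, LinearEquiv.apply_symm_apply]
    exact isPreparataPair_zero_left hw
  · rw [hammingNorm_eq_add_halves e, LinearEquiv.apply_symm_apply, hammingNorm_zero, zero_add,
      hnorm]

lemma exists_mem_preparata_add_notMem (hF : Fintype.card F = 2 ^ n) (hn : Odd n) (hn2 : 2 ≤ n)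
    (hs : s.Coprime n) (e : (Fin m → ZMod 2) ≃ₗ[ZMod 2] F × ZMod 2) :
    ∃ c ∈ preparata e s, ∃ c' ∈ preparata e s, c + c' ∉ preparata e s := by
  obtain ⟨u, w, u', w', h, h', hnot⟩ := exists_isPreparataPair_add_not hF hn hn2 hs
  refine ⟨(halves e).symm (u, w), ?_, (halves e).symm (u', w'), ?_, ?_⟩
  · rwa [mem_preparata_iff, LinearEquiv.apply_symm_apply]
  · rwa [mem_preparata_iff, LinearEquiv.apply_symm_apply]
  · rwa [mem_preparata_iff, map_add, LinearEquiv.apply_symm_apply, LinearEquiv.apply_symm_apply]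

/-- The components of the syndromes of the two halves are sums `∑ f(p) g(p)`, where `g` is built
from the coordinates `(x, i)` of `p` and is one of the functions `1`, `i`, `x`, `i x`, `x^σ x`, all
of algebraic degree at most two. -/
lemma exists_syndrome_halves_of_mem_reedMuller (hr : r + 2 < m) (hf : f ∈ reedMuller r m) (s : ℕ)
    (e : (Fin m → ZMod 2) ≃ₗ[ZMod 2] F × ZMod 2) :
    ∃ γ, syndrome F s (halves e f).1 = (0, 0, γ) ∧ syndrome F s (halves e f).2 = (0, 0, γ) := by
  have := charP_two_of_algebra F
  let x : (Fin m → ZMod 2) →ₗ[ZMod 2] F := LinearMap.fst _ _ _ ∘ₗ e.toLinearMap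
  let i : (Fin m → ZMod 2) →ₗ[ZMod 2] ZMod 2 := LinearMap.snd _ _ _ ∘ₗ e.toLinearMap
  let frob : F →ₗ[ZMod 2] F := (iterateFrobenius F 2 s).toAddMonoidHom.toZModLinearMap 2
  have hone : ∑ p, f p = 0 := sum_eq_zero_of_mem_reedMuller (by omega) hf
  have hi : ∑ p, f p • i p = 0 :=
    (hasAlgebraicDegreeLE_linearMap i).sum_smul_eq_zero (by omega) hf
  have hx : ∑ p, f p • x p = 0 :=
    (hasAlgebraicDegreeLE_linearMap x).sum_smul_eq_zero (by omega) hf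
  have hix : ∑ p, f p • i p • x p = 0 :=
    (hasAlgebraicDegreeLE_bilinear ((LinearMap.lsmul (ZMod 2) F).compl₁₂ i x)).sum_smul_eq_zero
      hr hf
  have hpow : ∑ p, f p • (x p ^ 2 ^ s * x p) = 0 :=
    (hasAlgebraicDegreeLE_bilinear
      ((LinearMap.mul (ZMod 2) F).compl₁₂ (frob ∘ₗ x) x)).sum_smul_eq_zero hr hf
  rw [sum_eq_sum_halves e] at hone hi hx hix hpow
  simp only [x, i, LinearMap.comp_apply, LinearEquiv.coe_coe, LinearEquiv.apply_symm_apply,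
    LinearMap.fst_apply, LinearMap.snd_apply, zero_smul, smul_zero, Finset.sum_const_zero,
    zero_add, one_smul, smul_eq_mul, mul_one, mul_zero, ← pow_succ] at hi hx hix hpow
  rw [hi, add_zero] at hone
  rw [hix, add_zero] at hx
  exact ⟨_, (syndrome_apply s _).trans (Prod.ext hone (Prod.ext hx (CharTwo.add_eq_zero.1 hpow))),
    (syndrome_apply s _).trans (Prod.ext hi (Prod.ext hix rfl))⟩

theorem add_mem_preparata (hr : r + 2 < m) (hc : c ∈ preparata e s) (hf : f ∈ reedMuller r m) :
    c + f ∈ preparata e s := by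
  rw [mem_preparata_iff] at hc ⊢
  obtain ⟨b, c, hu, hw⟩ := hc
  obtain ⟨γ, hγ, hγ'⟩ := exists_syndrome_halves_of_mem_reedMuller hr hf s e
  refine ⟨b, c + γ, ?_, ?_⟩
  · rw [map_add, Prod.fst_add, map_add, hu, hγ, Prod.mk_add_mk, Prod.mk_add_mk, add_zero, add_zero]
  · rw [map_add, Prod.snd_add, map_add, hw, hγ', Prod.mk_add_mk, Prod.mk_add_mk, add_zero, add_zero,
      add_right_comm]

lemma finrank_eq_of_card_eq_two_pow {V : Type*} [AddCommGroup V] [Module (ZMod 2) V] [Fintype V]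
    (hV : Fintype.card V = 2 ^ n) : Module.finrank (ZMod 2) V = n := by
  rw [Module.card_eq_pow_finrank (K := ZMod 2), ZMod.card] at hV
  exact Nat.pow_right_injective le_rfl hV

lemma ncard_preimage_of_surjective {R V W : Type*} [Ring R] [AddCommGroup V] [Module R V]
    [AddCommGroup W] [Module R W] {φ : V →ₗ[R] W} (hφ : Function.Surjective φ) (A : Set W) :
    (φ ⁻¹' A).ncard = Nat.card (LinearMap.ker φ) * A.ncard := by
  let ψ : V ⧸ (LinearMap.ker φ).toAddSubgroup ≃ W := (φ.quotKerEquivOfSurjective hφ).toEquiv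
  have hpre : φ ⁻¹' A = QuotientAddGroup.mk ⁻¹' (ψ ⁻¹' A) := rfl
  rw [hpre, ← Nat.card_coe_set_eq,
    Nat.card_congr (QuotientAddGroup.preimageMkEquivAddSubgroupProdSet _ _), Nat.card_prod,
    Nat.card_coe_set_eq, Set.ncard_preimage_of_injective_subset_range ψ.injective
      (ψ.surjective.range_eq ▸ Set.subset_univ A)]
  rfl

theorem ncard_preparata (hF : Fintype.card F = 2 ^ n) (hn : Odd n) (hn2 : 2 ≤ n)
    (hs : s.Coprime n) (e : (Fin m → ZMod 2) ≃ₗ[ZMod 2] F × ZMod 2) :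
    (preparata e s).ncard = 2 ^ (2 * 2 ^ n - 2 * n - 2) := by
  have hsurj := syndrome_surjective hF hn hn2 hs
  let L := ((syndrome F s).prodMap (syndrome F s)) ∘ₗ (halves e).toLinearMap
  have hL : Function.Surjective L := (hsurj.prodMap hsurj).comp (halves e).surjective
  let g : F × F → (ZMod 2 × F × F) × (ZMod 2 × F × F) := fun p =>
    ((0, p.1, p.2), (0, p.1, p.2 + p.1 ^ (2 ^ s + 1)))
  have hg : Function.Injective g := fun p q h => by
    simpa using congrArg (fun z => z.1.2) h
  have hpre : preparata e s = L ⁻¹' Set.range g := by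
    ext c
    rw [mem_preparata_iff, Set.mem_preimage, Set.mem_range, Prod.exists]
    exact exists₂_congr fun b c => (and_congr eq_comm eq_comm).trans
      (Prod.ext_iff (x := g (b, c)) (y := L _)).symm
  have hker := LinearMap.finrank_range_add_finrank_ker L
  rw [LinearMap.range_eq_top.2 hL, finrank_top, (halves e).finrank_eq] at hker
  simp only [Module.finrank_prod, Module.finrank_self, Module.finrank_fintype_fun_eq_card,
    finrank_eq_of_card_eq_two_pow hF, hF] at hker
  rw [hpre, ncard_preimage_of_surjective hL, Set.ncard_range_of_injective hg,
    Module.natCard_eq_pow_finrank (K := ZMod 2), Nat.card_zmod, Nat.card_prod,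
    Nat.card_eq_fintype_card, hF, ← pow_add, ← pow_add]
  congr 1
  omega

end Preparata

/-! ### Coset decompositions -/

section Cosets

variable {ι : Type*} {C : Submodule (ZMod 2) (ι → ZMod 2)}

lemma exists_isCosetDecomposition [Finite ι] {S : Set (ι → ZMod 2)}
    (hS : ∀ v ∈ S, ∀ c ∈ C, v + c ∈ S) :
    ∃ T, IsCosetDecomposition C T S := by
  classical
  have := Fintype.ofFinite ι
  let rep (v : ι → ZMod 2) : ι → ZMod 2 := (C.mkQ v).out
  have hrep (v : ι → ZMod 2) : C.mkQ (rep v) = C.mkQ v := Quotient.out_eq _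
  refine ⟨S.toFinset.image rep, fun v => ⟨fun hv => ⟨rep v, ?_, ?_⟩, ?_⟩, ?_⟩
  · exact Finset.mem_image_of_mem _ (Set.mem_toFinset.2 hv)
  · rw [← Submodule.Quotient.eq]
    exact (hrep v).symm
  · rintro ⟨t, ht, hvt⟩
    obtain ⟨v', hv', rfl⟩ := Finset.mem_image.1 ht
    have hvv' : v - v' ∈ C := by
      rw [← Submodule.Quotient.eq] at hvt ⊢
      exact hvt.trans (hrep v')
    simpa using hS v' (Set.mem_toFinset.1 hv') _ hvv'
  · intro t ht t' ht' h
    obtain ⟨v, -, rfl⟩ := Finset.mem_image.1 ht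
    obtain ⟨v', -, rfl⟩ := Finset.mem_image.1 ht'
    rw [← Submodule.Quotient.eq] at h
    exact congrArg Quotient.out ((hrep v).symm.trans (h.trans (hrep v')))

lemma IsCosetDecomposition.card_mul_card {T : Finset (ι → ZMod 2)} {S : Set (ι → ZMod 2)}
    (h : IsCosetDecomposition C T S) : T.card * Nat.card C = S.ncard := by
  have hinj : Set.InjOn C.mkQ T := fun t ht t' ht' heq =>
    h.2 t ht t' ht' ((Submodule.Quotient.eq C).1 heq)
  have hpre : S = C.mkQ ⁻¹' (C.mkQ '' T) := by
    ext v
    rw [h.1, Set.mem_preimage, Set.mem_image]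
    refine exists_congr fun t => and_congr_right fun _ => ?_
    rw [← Submodule.Quotient.eq, eq_comm]
    rfl
  rw [hpre, ncard_preimage_of_surjective C.mkQ_surjective, hinj.ncard_image,
    Set.ncard_coe_finset, mul_comm, Submodule.ker_mkQ]

end Cosets

/-! ### Pauli operators -/

section Pauli

/-- The sign character `z ↦ (-1)^z` of `𝔽₂`. -/
noncomputable def sgn : AddChar (ZMod 2) ℂ :=
  AddChar.zmodChar 2 (ζ := -1) (by norm_num)

lemma sgn_eq_one_iff {z : ZMod 2} : sgn z = 1 ↔ z = 0 := by
  have h : sgn 1 = -1 := by simp [sgn, AddChar.zmodChar_apply, ZMod.val_one]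
  rcases zmod_two_eq_zero_or_one z with rfl | rfl
  · simp
  · norm_num [h]

lemma sgn_mul_self (z : ZMod 2) : sgn z * sgn z = 1 := by
  rw [← AddChar.map_add_eq_mul, CharTwo.add_self_eq_zero, AddChar.map_zero_eq_one]

lemma conj_sgn (z : ZMod 2) : starRingEnd ℂ (sgn z) = sgn z := by
  simp [sgn, AddChar.zmodChar_apply]

variable {ι : Type*} [Fintype ι] [DecidableEq ι]

lemma pauliOp_apply (a b : ι → ZMod 2) (ψ : Qubits ι) (x : ι → ZMod 2) :
    pauliOp a b ψ x = sgn (b ⬝ᵥ (x + a)) * ψ (x + a) := rfl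

@[simp] lemma pauliOp_zero_zero (ψ : Qubits ι) : pauliOp 0 0 ψ = ψ := by
  ext x
  simp [pauliOp_apply]

lemma pauliOp_pauliOp (a b c d : ι → ZMod 2) (ψ : Qubits ι) :
    pauliOp a b (pauliOp c d ψ) = sgn (b ⬝ᵥ c) • pauliOp (a + c) (b + d) ψ := by
  ext x
  rw [PiLp.smul_apply, smul_eq_mul, pauliOp_apply, pauliOp_apply, pauliOp_apply, ← mul_assoc,
    ← mul_assoc, ← AddChar.map_add_eq_mul, ← AddChar.map_add_eq_mul, add_assoc x a c]
  congr 2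
  simp only [add_dotProduct, dotProduct_add]
  linear_combination -CharTwo.add_self_eq_zero (b ⬝ᵥ c)

lemma pauliOp_comm (p q : PhaseSpace ι) (ψ : Qubits ι) :
    pauliOp p.1 p.2 (pauliOp q.1 q.2 ψ) =
      sgn (symplecticForm ι p q) • pauliOp q.1 q.2 (pauliOp p.1 p.2 ψ) := by
  rw [pauliOp_pauliOp, pauliOp_pauliOp, smul_smul, symplecticForm_apply, dotProduct_comm p.1,
    AddChar.map_add_eq_mul, mul_right_comm, sgn_mul_self, one_mul, add_comm p.1, add_comm p.2]

lemma inner_pauliOp_pauliOp (a b : ι → ZMod 2) (φ ψ : Qubits ι) :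
    inner ℂ (pauliOp a b φ) (pauliOp a b ψ) = inner ℂ φ ψ := by
  rw [PiLp.inner_apply, PiLp.inner_apply,
    ← Equiv.sum_comp (Equiv.addRight a) (fun x => inner ℂ (φ x) (ψ x))]
  refine Finset.sum_congr rfl fun x _ => ?_
  simp only [pauliOp_apply, RCLike.inner_apply, map_mul, conj_sgn, Equiv.coe_addRight]
  linear_combination (ψ (x + a) * starRingEnd ℂ (φ (x + a))) * sgn_mul_self (b ⬝ᵥ (x + a))

lemma pauliOp_injective (a b : ι → ZMod 2) : Function.Injective (pauliOp a b) :=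
  (injective_iff_map_eq_zero _).2 fun ψ h => by
    rw [← inner_self_eq_zero (𝕜 := ℂ), ← inner_pauliOp_pauliOp a b, h, inner_zero_left]

/-- A vector of a stabilizer code that a Pauli operator `E` maps into the code shows that `E`
commutes with the whole stabilizer. -/
lemma IsStabilizerCode.pauliOp_mem {Q : Submodule ℂ (Qubits ι)} (hQ : IsStabilizerCode Q)
    {p : PhaseSpace ι} {ψ φ : Qubits ι} (hψ : ψ ∈ Q) (hψ0 : ψ ≠ 0)
    (hpψ : pauliOp p.1 p.2 ψ ∈ Q) (hφ : φ ∈ Q) : pauliOp p.1 p.2 φ ∈ Q := by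
  obtain ⟨-, S, hPauli, -, hS⟩ := hQ
  rw [hS] at hψ hpψ hφ ⊢
  intro g hg
  obtain ⟨k, c, d, rfl⟩ := hPauli g hg
  have hcomm (χ : Qubits ι) (hχ : (Complex.I ^ k • pauliOp c d) χ = χ) :
      (Complex.I ^ k • pauliOp c d) (pauliOp p.1 p.2 χ) =
        sgn (symplecticForm ι (c, d) p) • pauliOp p.1 p.2 χ := by
    conv_rhs => rw [← hχ]
    rw [LinearMap.smul_apply, LinearMap.smul_apply, map_smul, pauliOp_comm (c, d), smul_comm]
  have hsgn : sgn (symplecticForm ι (c, d) p) = 1 := by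
    have hpψ0 : pauliOp p.1 p.2 ψ ≠ 0 := (map_ne_zero_iff _ (pauliOp_injective _ _)).2 hψ0
    refine smul_left_injective ℂ hpψ0 ?_
    simpa only [one_smul] using (hcomm ψ (hψ _ hg)).symm.trans (hpψ _ hg)
  rw [hcomm φ (hφ _ hg), hsgn, one_smul]

end Pauli

/-! ### Joint eigenspaces of commuting Pauli operators -/

section PauliEigenspace

variable {ι : Type*} [Fintype ι]

/-- `p ↦ X^{p.1} Z^{p.2}` is multiplicative on `S`, with no phases. Such an `S` is isotropic, and
its Pauli operators form a stabilizer group. -/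
def IsPhaseFree (S : Submodule (ZMod 2) (PhaseSpace ι)) : Prop :=
  ∀ p ∈ S, ∀ q ∈ S, p.2 ⬝ᵥ q.1 = 0

lemma IsPhaseFree.mono {S S' : Submodule (ZMod 2) (PhaseSpace ι)}
    (hS : IsPhaseFree S) (h : S' ≤ S) : IsPhaseFree S' :=
  fun p hp q hq => hS p (h hp) q (h hq)

variable [DecidableEq ι]

lemma IsPhaseFree.pauliOp_pauliOp {S : Submodule (ZMod 2) (PhaseSpace ι)}
    (hS : IsPhaseFree S) {p q : PhaseSpace ι} (hp : p ∈ S) (hq : q ∈ S)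
    (ψ : Qubits ι) :
    pauliOp p.1 p.2 (pauliOp q.1 q.2 ψ) = pauliOp (p + q).1 (p + q).2 ψ := by
  rw [UnionCode.pauliOp_pauliOp, hS p hp q hq, AddChar.map_zero_eq_one, one_smul]
  rfl

/-- The joint eigenspace of the Pauli operators of `S` on which `p ∈ S` acts by the sign with which
it commutes with the Pauli operator of `t`; for `t = 0` it is the code stabilized by `S`. -/
noncomputable def pauliEigenspace (S : Submodule (ZMod 2) (PhaseSpace ι))
    (t : PhaseSpace ι) : Submodule ℂ (Qubits ι) :=
  ⨅ p ∈ S, Module.End.eigenspace (pauliOp p.1 p.2) (sgn (symplecticForm ι p t))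

variable {S : Submodule (ZMod 2) (PhaseSpace ι)}
  {t t' : PhaseSpace ι} {ψ φ : Qubits ι}

lemma mem_pauliEigenspace :
    ψ ∈ pauliEigenspace S t ↔
      ∀ p ∈ S, pauliOp p.1 p.2 ψ = sgn (symplecticForm ι p t) • ψ := by
  simp only [pauliEigenspace, Submodule.mem_iInf, Module.End.mem_eigenspace_iff]

lemma mem_pauliEigenspace_zero :
    ψ ∈ pauliEigenspace S 0 ↔ ∀ p ∈ S, pauliOp p.1 p.2 ψ = ψ := by
  simp only [mem_pauliEigenspace, map_zero, AddChar.map_zero_eq_one, one_smul]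

lemma pauliOp_mem_pauliEigenspace (hψ : ψ ∈ pauliEigenspace S t)
    (c : PhaseSpace ι) : pauliOp c.1 c.2 ψ ∈ pauliEigenspace S (c + t) := by
  rw [mem_pauliEigenspace] at hψ ⊢
  intro p hp
  rw [pauliOp_comm, hψ p hp, map_smul, smul_smul, ← AddChar.map_add_eq_mul,
    (symplecticForm ι p).map_add]

lemma map_pauliOp_pauliEigenspace (S : Submodule (ZMod 2) (PhaseSpace ι))
    (c t : PhaseSpace ι) :
    (pauliEigenspace S t).map (pauliOp c.1 c.2) = pauliEigenspace S (c + t) := by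
  apply le_antisymm
  · rintro _ ⟨ψ, hψ, rfl⟩
    exact pauliOp_mem_pauliEigenspace hψ c
  · intro ψ hψ
    have hinv : pauliOp c.1 c.2 (pauliOp c.1 c.2 ψ) = sgn (c.2 ⬝ᵥ c.1) • ψ := by
      simp only [pauliOp_pauliOp, ZModModule.add_self, pauliOp_zero_zero]
    refine ⟨sgn (c.2 ⬝ᵥ c.1) • pauliOp c.1 c.2 ψ, ?_, ?_⟩
    · have hmem := pauliOp_mem_pauliEigenspace hψ c
      rw [← add_assoc, ZModModule.add_self, zero_add] at hmem
      exact Submodule.smul_mem _ _ hmem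
    · rw [map_smul, hinv, smul_smul, sgn_mul_self, one_smul]

lemma finrank_pauliEigenspace (S : Submodule (ZMod 2) (PhaseSpace ι))
    (t : PhaseSpace ι) :
    Module.finrank ℂ (pauliEigenspace S t) = Module.finrank ℂ (pauliEigenspace S 0) := by
  rw [← add_zero t, ← map_pauliOp_pauliEigenspace S t 0]
  exact (Submodule.equivMapOfInjective _ (pauliOp_injective t.1 t.2) _).finrank_eq.symm

lemma unionCode_pauliEigenspace_zero (T : Set (PhaseSpace ι)) :
    unionCode (pauliEigenspace S 0) T = ⨆ t ∈ T, pauliEigenspace S t := by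
  simp only [unionCode, map_pauliOp_pauliEigenspace, add_zero]

lemma pauliEigenspace_eq_of_sub_mem_orthogonal (h : t - t' ∈ (symplecticForm ι).orthogonal S) :
    pauliEigenspace S t = pauliEigenspace S t' := by
  ext ψ
  simp only [mem_pauliEigenspace]
  refine forall₂_congr fun p hp => ?_
  rw [← sub_add_cancel t t', map_add, h p hp, zero_add]

lemma inner_eq_zero_of_sub_notMem_orthogonal (h : t - t' ∉ (symplecticForm ι).orthogonal S)
    (hψ : ψ ∈ pauliEigenspace S t) (hφ : φ ∈ pauliEigenspace S t') : inner ℂ ψ φ = 0 := by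
  rw [mem_pauliEigenspace] at hψ hφ
  simp only [LinearMap.BilinForm.mem_orthogonal_iff, not_forall] at h
  obtain ⟨p, hp, hne⟩ := h
  have hinner := inner_pauliOp_pauliOp p.1 p.2 ψ φ
  rw [hψ p hp, hφ p hp, inner_smul_left, inner_smul_right, conj_sgn, ← mul_assoc,
    ← AddChar.map_add_eq_mul, ← map_add, ← ZModModule.sub_eq_add] at hinner
  by_contra h0
  exact hne (sgn_eq_one_iff.1 (mul_right_cancel₀ h0 (hinner.trans (one_mul _).symm)))

end PauliEigenspace

/-! ### Sums of eigenspaces -/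

section SumOfEigenspaces

variable {ι : Type*} [Fintype ι] {S : Submodule (ZMod 2) (PhaseSpace ι)}

lemma sum_sgn_symplecticForm (L : Submodule (ZMod 2) (PhaseSpace ι)) [Fintype L]
    (p : PhaseSpace ι) [Decidable (p ∈ (symplecticForm ι).orthogonal L)] :
    ∑ t : L, sgn (symplecticForm ι p t) =
      if p ∈ (symplecticForm ι).orthogonal L then (Fintype.card L : ℂ) else 0 := by
  let χ : AddChar L ℂ :=
    sgn.compAddMonoidHom ((symplecticForm ι p).domRestrict L).toAddMonoidHom
  have hχ : χ = 0 ↔ p ∈ (symplecticForm ι).orthogonal L := by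
    rw [AddChar.eq_zero_iff, LinearMap.BilinForm.mem_orthogonal_iff, Subtype.forall]
    exact forall₂_congr fun t _ => sgn_eq_one_iff.trans symplecticForm_isSymm.isRefl.eq_iff
  classical
  refine (AddChar.sum_eq_ite χ).trans ?_
  simp only [hχ]

variable [DecidableEq ι]

open Classical in
/-- The projection onto `pauliEigenspace S t`, multiplied by the order of `S`. -/
noncomputable def pauliEigenspaceSum (S : Submodule (ZMod 2) (PhaseSpace ι))
    (t : PhaseSpace ι) (ψ : Qubits ι) : Qubits ι :=
  ∑ p : S, sgn (symplecticForm ι p t) • pauliOp p.1.1 p.1.2 ψ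

lemma pauliEigenspaceSum_mem (hS : IsPhaseFree S) (t : PhaseSpace ι)
    (ψ : Qubits ι) : pauliEigenspaceSum S t ψ ∈ pauliEigenspace S t := by
  classical
  rw [mem_pauliEigenspace]
  intro q hq
  rw [pauliEigenspaceSum, map_sum, Finset.smul_sum,
    ← Equiv.sum_comp (Equiv.addLeft (⟨q, hq⟩ : S)) fun p : S =>
      sgn (symplecticForm ι q t) • sgn (symplecticForm ι p t) • pauliOp p.1.1 p.1.2 ψ]
  refine Finset.sum_congr rfl fun p _ => ?_
  rw [map_smul, hS.pauliOp_pauliOp hq p.2, smul_smul, Equiv.coe_addLeft, Submodule.coe_add,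
    map_add, LinearMap.add_apply, AddChar.map_add_eq_mul, ← mul_assoc, sgn_mul_self, one_mul]

open Classical in
lemma sum_pauliEigenspaceSum (L : Submodule (ZMod 2) (PhaseSpace ι))
    {ψ : Qubits ι} (hψ : ψ ∈ pauliEigenspace (S ⊓ (symplecticForm ι).orthogonal L) 0) :
    ∑ t : L, pauliEigenspaceSum S t ψ =
      ((Fintype.card L : ℂ) *
        Fintype.card {p : S // (p : PhaseSpace ι) ∈ (symplecticForm ι).orthogonal L}) • ψ := by
  rw [mem_pauliEigenspace_zero] at hψ
  calc ∑ t : L, pauliEigenspaceSum S t ψ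
      = ∑ p : S, (∑ t : L, sgn (symplecticForm ι p t)) • pauliOp p.1.1 p.1.2 ψ := by
        simp only [pauliEigenspaceSum, Finset.sum_smul]
        exact Finset.sum_comm
    _ = ∑ p : S, if (p : PhaseSpace ι) ∈ (symplecticForm ι).orthogonal L
          then (Fintype.card L : ℂ) • ψ else 0 := by
        refine Finset.sum_congr rfl fun p _ => ?_
        rw [sum_sgn_symplecticForm]
        split_ifs with hp
        · rw [hψ p ⟨p.2, hp⟩]
        · exact zero_smul _ _
    _ = _ := by
        rw [← Finset.sum_filter, Finset.sum_const, ← Fintype.card_subtype,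
          ← Nat.cast_smul_eq_nsmul ℂ, smul_smul, mul_comm]

/-- Averaging a vector fixed by `S ∩ L^⊥` over the characters of `S` given by `L` decomposes it into
joint eigenvectors of `S`. -/
theorem iSup_pauliEigenspace (hS : IsPhaseFree S)
    (L : Submodule (ZMod 2) (PhaseSpace ι)) :
    ⨆ t ∈ L, pauliEigenspace S t =
      pauliEigenspace (S ⊓ (symplecticForm ι).orthogonal L) 0 := by
  classical
  apply le_antisymm
  · refine iSup₂_le fun t ht ψ hψ => mem_pauliEigenspace_zero.2 fun p ⟨hpS, hpL⟩ => ?_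
    rw [mem_pauliEigenspace.1 hψ p hpS, symplecticForm_isSymm.isRefl.eq_iff.1 (hpL t ht),
      AddChar.map_zero_eq_one, one_smul]
  · intro ψ hψ
    have hsum : ∑ t : L, pauliEigenspaceSum S t ψ ∈ ⨆ t ∈ L, pauliEigenspace S t :=
      Submodule.sum_mem _ fun t _ =>
        le_iSup₂_of_le (f := fun t (_ : t ∈ L) => pauliEigenspace S t) t.1 t.2 le_rfl
          (pauliEigenspaceSum_mem hS t ψ)
    rw [sum_pauliEigenspaceSum L hψ] at hsum
    refine (Submodule.smul_mem_iff _ (mul_ne_zero ?_ ?_)).1 hsum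
    · exact Nat.cast_ne_zero.2 Fintype.card_ne_zero
    · have : Nonempty {p : S // (p : PhaseSpace ι) ∈ (symplecticForm ι).orthogonal L} :=
        ⟨⟨0, zero_mem _⟩⟩
      exact Nat.cast_ne_zero.2 Fintype.card_ne_zero

lemma finrank_iSup_of_iSupIndep {K V α : Type*} [Field K] [AddCommGroup V] [Module K V]
    [FiniteDimensional K V] [Fintype α] {p : α → Submodule K V} (hp : iSupIndep p) :
    Module.finrank K ↥(⨆ i, p i) = ∑ i, Module.finrank K (p i) := by
  classical
  rw [Submodule.iSup_eq_range_dfinsupp_lsum,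
    LinearMap.finrank_range_of_inj hp.dfinsupp_lsum_injective]
  exact Module.finrank_directSum K fun i => p i

lemma finrank_iSup_pauliEigenspace (T : Finset (PhaseSpace ι))
    (hT : (T : Set _).Pairwise fun t t' => t - t' ∉ (symplecticForm ι).orthogonal S) :
    Module.finrank ℂ ↥(⨆ t ∈ T, pauliEigenspace S t) =
      T.card * Module.finrank ℂ (pauliEigenspace S 0) := by
  have hortho : OrthogonalFamily ℂ (fun t : T => pauliEigenspace S t)
      fun t => (pauliEigenspace S t).subtypeₗᵢ := fun t t' hne ψ φ =>
    inner_eq_zero_of_sub_notMem_orthogonal (hT t.2 t'.2 (Subtype.coe_injective.ne hne)) ψ.2 φ.2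
  rw [iSup_subtype', finrank_iSup_of_iSupIndep hortho.independent]
  simp only [finrank_pauliEigenspace S, Finset.sum_const, Finset.card_univ, Fintype.card_coe,
    smul_eq_mul]

/-- The eigenspaces of a set of representatives of the characters of `S` add up to the whole
space. -/
lemma two_pow_finrank_mul_finrank_pauliEigenspace (hS : IsPhaseFree S) :
    2 ^ Module.finrank (ZMod 2) S * Module.finrank ℂ (pauliEigenspace S 0) =
      2 ^ Fintype.card ι := by
  classical
  obtain ⟨L, hL⟩ := Submodule.exists_isCompl ((symplecticForm ι).orthogonal S)
  have hinf : S ⊓ (symplecticForm ι).orthogonal L = ⊥ := by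
    rw [eq_bot_iff, ← LinearMap.BilinForm.orthogonal_top_eq_bot symplecticForm_nondegenerate,
      ← hL.sup_eq_top]
    rintro p ⟨hpS, hpL⟩ v hv
    obtain ⟨a, ha, b, hb, rfl⟩ := Submodule.mem_sup.1 hv
    rw [map_add, LinearMap.add_apply, symplecticForm_isSymm.isRefl.eq_iff.1 (ha p hpS), hpL b hb,
      add_zero]
  have htop : ⨆ t ∈ (L : Set (PhaseSpace ι)).toFinset, pauliEigenspace S t = ⊤ := by
    simp only [Set.mem_toFinset, SetLike.mem_coe]
    rw [iSup_pauliEigenspace hS, hinf, eq_top_iff]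
    rintro ψ -
    simp [mem_pauliEigenspace_zero]
  have hcard : Fintype.card L = 2 ^ Module.finrank (ZMod 2) S := by
    rw [Module.card_eq_pow_finrank (K := ZMod 2), ZMod.card]
    congr 1
    have h₁ := Submodule.finrank_add_eq_of_isCompl hL
    have h₂ := LinearMap.BilinForm.finrank_orthogonal (symplecticForm_nondegenerate (ι := ι)) S
    have h₃ := S.finrank_le
    omega
  have hpairwise : (L : Set (PhaseSpace ι)).Pairwise fun t t' =>
      t - t' ∉ (symplecticForm ι).orthogonal S :=
    fun t ht t' ht' hne hmem =>
      hne (sub_eq_zero.1 (Submodule.disjoint_def.1 hL.disjoint _ hmem (L.sub_mem ht ht')))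
  have hsum := finrank_iSup_pauliEigenspace (L : Set (PhaseSpace ι)).toFinset
    (by rwa [Set.coe_toFinset])
  rw [htop, finrank_top, finrank_euclideanSpace, Fintype.card_fun, ZMod.card,
    Set.toFinset_card] at hsum
  rw [hsum, ← hcard]
  rfl

end SumOfEigenspaces

/-! ### Unions of eigenspaces as quantum codes -/

section UnionOfEigenspaces

variable {ι : Type*} [Fintype ι] [DecidableEq ι] {S : Submodule (ZMod 2) (PhaseSpace ι)}
  {T : Set (PhaseSpace ι)}

lemma pauliEigenspace_ne_bot (hS : IsPhaseFree S) (t : PhaseSpace ι) :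
    pauliEigenspace S t ≠ ⊥ := by
  intro h
  have hcard := two_pow_finrank_mul_finrank_pauliEigenspace hS
  rw [← finrank_pauliEigenspace S t, h, finrank_bot, mul_zero] at hcard
  exact absurd hcard.symm (by positivity)

lemma isStabilizerCode_pauliEigenspace_zero (hS : IsPhaseFree S) :
    IsStabilizerCode (pauliEigenspace S 0) := by
  refine ⟨pauliEigenspace_ne_bot hS 0, {g | ∃ p ∈ S, pauliOp p.1 p.2 = g}, ?_, ?_, fun ψ => ?_⟩
  · rintro _ ⟨p, -, rfl⟩
    exact ⟨0, p.1, p.2, by rw [pow_zero, one_smul]⟩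
  · rintro _ ⟨p, hp, rfl⟩ _ ⟨q, hq, rfl⟩
    refine LinearMap.ext fun ψ => ?_
    rw [Module.End.mul_apply, Module.End.mul_apply, hS.pauliOp_pauliOp hp hq,
      hS.pauliOp_pauliOp hq hp, add_comm]
  · simp only [mem_pauliEigenspace_zero, Set.mem_ofPred_eq, forall_exists_index, and_imp,
      forall_apply_eq_imp_iff₂]

lemma isOrtho_iSup_pauliEigenspace {u : PhaseSpace ι}
    (h : ∀ t ∈ T, u - t ∉ (symplecticForm ι).orthogonal S) :
    pauliEigenspace S u ⟂ ⨆ t ∈ T, pauliEigenspace S t := by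
  simp only [Submodule.isOrtho_iSup_right]
  exact fun t ht => Submodule.isOrtho_iff_inner_eq.2 fun ψ hψ φ hφ =>
    inner_eq_zero_of_sub_notMem_orthogonal (h t ht) hψ hφ

lemma detects_pauliOp_zero (Q : Submodule ℂ (Qubits ι)) : Detects Q (pauliOp 0 0) :=
  ⟨1, fun φ _ ψ _ => by rw [pauliOp_zero_zero, one_mul]⟩

lemma detects_iSup_pauliEigenspace {p : PhaseSpace ι}
    (h : ∀ t ∈ T, ∀ t' ∈ T, p + t - t' ∉ (symplecticForm ι).orthogonal S) :
    Detects (⨆ t ∈ T, pauliEigenspace S t) (pauliOp p.1 p.2) := by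
  have hortho : (⨆ t ∈ T, pauliEigenspace S t).map (pauliOp p.1 p.2) ⟂
      ⨆ t ∈ T, pauliEigenspace S t := by
    simp only [Submodule.map_iSup, map_pauliOp_pauliEigenspace, Submodule.isOrtho_iSup_left]
    exact fun t ht => isOrtho_iSup_pauliEigenspace (h t ht)
  refine ⟨0, fun φ hφ ψ hψ => ?_⟩
  rw [zero_mul]
  exact Submodule.isOrtho_iff_inner_eq.1 hortho.symm φ hφ _ (Submodule.mem_map_of_mem hψ)

lemma not_detects_iSup_pauliEigenspace (hS : IsPhaseFree S) {p t t' : PhaseSpace ι}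
    (ht : t ∈ T) (ht' : t' ∈ T) (hp : p ∉ (symplecticForm ι).orthogonal S)
    (hpt : p + t - t' ∈ (symplecticForm ι).orthogonal S) :
    ¬ Detects (⨆ t ∈ T, pauliEigenspace S t) (pauliOp p.1 p.2) := by
  rintro ⟨c, hc⟩
  obtain ⟨ψ, hψ, hψ0⟩ := Submodule.exists_mem_ne_zero_of_ne_bot (pauliEigenspace_ne_bot hS t)
  have hEψ := pauliOp_mem_pauliEigenspace hψ p
  have hortho : inner ℂ (pauliOp p.1 p.2 ψ) ψ = 0 :=
    inner_eq_zero_of_sub_notMem_orthogonal (by rwa [add_sub_cancel_right]) hEψ hψ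
  rw [pauliEigenspace_eq_of_sub_mem_orthogonal hpt] at hEψ
  have hself := hc _ (Submodule.mem_iSup_of_mem t' (Submodule.mem_iSup_of_mem ht' hEψ)) ψ
    (Submodule.mem_iSup_of_mem t (Submodule.mem_iSup_of_mem ht hψ))
  rw [hortho, mul_zero, inner_pauliOp_pauliOp] at hself
  exact hψ0 (inner_self_eq_zero.1 hself)

lemma not_isStabilizerCode_iSup_pauliEigenspace (hS : IsPhaseFree S) {p t t' t'' : PhaseSpace ι}
    (ht : t ∈ T) (ht' : t' ∈ T) (ht'' : t'' ∈ T)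
    (hpt : p + t - t' ∈ (symplecticForm ι).orthogonal S)
    (hpt'' : ∀ u ∈ T, p + t'' - u ∉ (symplecticForm ι).orthogonal S) :
    ¬ IsStabilizerCode (⨆ t ∈ T, pauliEigenspace S t) := by
  intro hQ
  obtain ⟨ψ, hψ, hψ0⟩ := Submodule.exists_mem_ne_zero_of_ne_bot (pauliEigenspace_ne_bot hS t)
  obtain ⟨φ, hφ, hφ0⟩ := Submodule.exists_mem_ne_zero_of_ne_bot (pauliEigenspace_ne_bot hS t'')
  have hEψ := pauliOp_mem_pauliEigenspace hψ p
  rw [pauliEigenspace_eq_of_sub_mem_orthogonal hpt] at hEψ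
  have hEφ := hQ.pauliOp_mem (Submodule.mem_iSup_of_mem t (Submodule.mem_iSup_of_mem ht hψ)) hψ0
    (Submodule.mem_iSup_of_mem t' (Submodule.mem_iSup_of_mem ht' hEψ))
    (Submodule.mem_iSup_of_mem t'' (Submodule.mem_iSup_of_mem ht'' hφ))
  have hself := Submodule.isOrtho_iff_inner_eq.1 (isOrtho_iSup_pauliEigenspace hpt'') _
    (pauliOp_mem_pauliEigenspace hφ p) _ hEφ
  rw [inner_pauliOp_pauliOp] at hself
  exact hφ0 (inner_self_eq_zero.1 hself)

end UnionOfEigenspaces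

/-! ### Weights of Pauli operators -/

section PauliWeight

variable {ι : Type*} [Fintype ι]

lemma hammingNorm_fst_le_pauliWeight (a b : ι → ZMod 2) : hammingNorm a ≤ pauliWeight a b :=
  Finset.card_le_card <| Finset.monotone_filter_right _ fun _ _ ha h => ha (congrArg Prod.fst h)

lemma hammingNorm_snd_le_pauliWeight (a b : ι → ZMod 2) : hammingNorm b ≤ pauliWeight a b :=
  Finset.card_le_card <| Finset.monotone_filter_right _ fun _ _ hb h => hb (congrArg Prod.snd h)

lemma pauliWeight_zero_right (a : ι → ZMod 2) : pauliWeight a 0 = hammingNorm a := by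
  simp only [pauliWeight, hammingNorm, Pi.zero_apply, ne_eq, Prod.mk_eq_zero, and_true]

lemma hammingNorm_add_hammingNorm_add (a b : ι → ZMod 2) :
    hammingNorm a + hammingNorm b + hammingNorm (a + b) = 2 * pauliWeight a b := by
  have hcoord : ∀ x y : ZMod 2, (if x ≠ 0 then 1 else 0) + (if y ≠ 0 then 1 else 0) +
      (if x + y ≠ 0 then 1 else 0) = 2 * if (x, y) ≠ 0 then 1 else 0 := by decide
  simp only [pauliWeight, hammingNorm, Finset.card_filter, Finset.mul_sum,
    ← Finset.sum_add_distrib]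
  exact Finset.sum_congr rfl fun i _ => hcoord (a i) (b i)

end PauliWeight

/-! ### CSS codes and CSS-like union codes -/

section CssUnion

lemma finrank_submodule_prod {K V W : Type*} [Field K] [AddCommGroup V] [Module K V]
    [AddCommGroup W] [Module K W] [FiniteDimensional K V] [FiniteDimensional K W]
    (p : Submodule K V) (q : Submodule K W) :
    Module.finrank K (p.prod q) = Module.finrank K p + Module.finrank K q := by
  have hrange : p.prod q = LinearMap.range (p.subtype.prodMap q.subtype) := by
    rw [LinearMap.range_prodMap, p.range_subtype, q.range_subtype]
  rw [hrange, LinearMap.finrank_range_of_inj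
    (p.subtype_injective.prodMap q.subtype_injective), Module.finrank_prod]

variable {ι : Type*} [Fintype ι] {C₁ C₂ : Submodule (ZMod 2) (ι → ZMod 2)}

lemma isPhaseFree_prod_dualCode (hC : dualCode C₂ ≤ C₁) :
    IsPhaseFree ((dualCode C₂).prod (dualCode C₁)) :=
  fun _ hp q hq => mem_dualCode.1 hp.2 q.1 (hC hq.1)

lemma IsCosetDecomposition.le_hammingNorm_of_add_sub_mem {C : Submodule (ZMod 2) (ι → ZMod 2)}
    {P : Set (ι → ZMod 2)} {T : Finset (ι → ZMod 2)} {d : ℕ} (h : IsCosetDecomposition C T P)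
    (hd : P.Pairwise fun c c' => d ≤ hammingDist c c') {a t t' : ι → ZMod 2} (ht : t ∈ T)
    (ht' : t' ∈ T) (ha : a + t - t' ∈ C) (ha0 : a ≠ 0) : d ≤ hammingNorm a := by
  have hdist : d ≤ hammingDist t (a + t) :=
    hd ((h.1 t).2 ⟨t, ht, by simp⟩) ((h.1 (a + t)).2 ⟨t', ht', ha⟩) (by simpa)
  rwa [hammingDist_eq_hammingNorm, neg_add_eq_sub, add_sub_cancel_right] at hdist

variable [DecidableEq ι]

lemma cssCode_eq_pauliEigenspace (C₁ C₂ : Submodule (ZMod 2) (ι → ZMod 2)) :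
    cssCode C₁ C₂ = pauliEigenspace ((dualCode C₂).prod (dualCode C₁)) 0 := by
  ext ψ
  rw [mem_pauliEigenspace_zero]
  constructor
  · rintro ⟨hX, hZ⟩ p ⟨hp₁, hp₂⟩
    have hsplit := pauliOp_pauliOp p.1 0 0 p.2 ψ
    rw [hZ _ hp₂, hX _ hp₁, zero_dotProduct, AddChar.map_zero_eq_one, one_smul, add_zero,
      zero_add] at hsplit
    exact hsplit.symm
  · exact fun h => ⟨fun a ha => h (a, 0) ⟨ha, zero_mem _⟩, fun b hb => h (0, b) ⟨zero_mem _, hb⟩⟩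

lemma finrank_cssCode (hC : dualCode C₂ ≤ C₁) :
    Module.finrank ℂ (cssCode C₁ C₂) =
      2 ^ (Module.finrank (ZMod 2) C₁ + Module.finrank (ZMod 2) C₂ - Fintype.card ι) := by
  have hcard := two_pow_finrank_mul_finrank_pauliEigenspace (isPhaseFree_prod_dualCode hC)
  rw [finrank_submodule_prod, ← cssCode_eq_pauliEigenspace] at hcard
  refine Nat.eq_of_mul_eq_mul_left (by positivity) (hcard.trans ?_)
  rw [← pow_add]
  congr 1
  have hle := Submodule.finrank_mono hC
  have := finrank_le_card C₁
  have := finrank_le_card C₂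
  rw [finrank_dualCode] at hle ⊢
  rw [finrank_dualCode]
  omega

lemma unionCode_cssCode (T : Set (PhaseSpace ι)) :
    unionCode (cssCode C₁ C₂) T =
      ⨆ t ∈ T, pauliEigenspace ((dualCode C₂).prod (dualCode C₁)) t := by
  rw [cssCode_eq_pauliEigenspace, unionCode_pauliEigenspace_zero]

lemma finrank_unionCode_cssCode {T : Finset (PhaseSpace ι)}
    (hT : (T : Set (PhaseSpace ι)).Pairwise fun t t' => t - t' ∉ C₁.prod C₂) :
    Module.finrank ℂ (unionCode (cssCode C₁ C₂) T) =
      T.card * Module.finrank ℂ (cssCode C₁ C₂) := by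
  rw [unionCode_cssCode, cssCode_eq_pauliEigenspace]
  exact finrank_iSup_pauliEigenspace T
    (by simpa only [symplecticForm_orthogonal_prod_dualCode] using hT)

lemma detects_unionCode_cssCode {T : Set (PhaseSpace ι)} {p : PhaseSpace ι}
    (h : ∀ t ∈ T, ∀ t' ∈ T, p + t - t' ∉ C₁.prod C₂) :
    Detects (unionCode (cssCode C₁ C₂) T) (pauliOp p.1 p.2) := by
  rw [unionCode_cssCode]
  exact detects_iSup_pauliEigenspace
    (by simpa only [symplecticForm_orthogonal_prod_dualCode] using h)

variable {P₁ P₂ : Set (ι → ZMod 2)} {T₁ T₂ : Finset (ι → ZMod 2)} {d : ℕ}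

lemma finrank_cssUnionCode (h₁ : IsCosetDecomposition C₁ T₁ P₁)
    (h₂ : IsCosetDecomposition C₂ T₂ P₂) :
    Module.finrank ℂ (cssUnionCode C₁ C₂ T₁ T₂) =
      T₁.card * T₂.card * Module.finrank ℂ (cssCode C₁ C₂) := by
  have hT : {t : PhaseSpace ι | t.1 ∈ T₁ ∧ t.2 ∈ T₂} = ↑(T₁ ×ˢ T₂) := by
    ext t
    simp
  rw [cssUnionCode, hT, finrank_unionCode_cssCode, Finset.card_product]
  intro t ht t' ht' hne hmem
  simp only [Finset.coe_product, Set.mem_prod, Finset.mem_coe] at ht ht'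
  exact hne (Prod.ext (h₁.2 _ ht.1 _ ht'.1 hmem.1) (h₂.2 _ ht.2 _ ht'.2 hmem.2))

lemma le_of_mem_undetectedWeights_cssUnionCode (h₁ : IsCosetDecomposition C₁ T₁ P₁)
    (h₂ : IsCosetDecomposition C₂ T₂ P₂) (hd₁ : P₁.Pairwise fun c c' => d ≤ hammingDist c c')
    (hd₂ : P₂.Pairwise fun c c' => d ≤ hammingDist c c') {w : ℕ}
    (hw : w ∈ undetectedWeights (cssUnionCode C₁ C₂ T₁ T₂)) : d ≤ w := by
  obtain ⟨a, b, rfl, hdet⟩ := hw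
  contrapose! hdet
  by_cases hab : a = 0 ∧ b = 0
  · rw [hab.1, hab.2]
    exact detects_pauliOp_zero _
  refine detects_unionCode_cssCode (p := (a, b)) fun t ht t' ht' hmem => hab ⟨?_, ?_⟩
  · by_contra ha0
    have hle : d ≤ hammingNorm a := h₁.le_hammingNorm_of_add_sub_mem hd₁ ht.1 ht'.1 hmem.1 ha0
    exact absurd (hammingNorm_fst_le_pauliWeight a b) (by omega)
  · by_contra hb0
    have hle : d ≤ hammingNorm b := h₂.le_hammingNorm_of_add_sub_mem hd₂ ht.2 ht'.2 hmem.2 hb0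
    exact absurd (hammingNorm_snd_le_pauliWeight a b) (by omega)

lemma hammingDist_mem_undetectedWeights_cssUnionCode (hC : dualCode C₂ ≤ C₁)
    (h₁ : IsCosetDecomposition C₁ T₁ P₁) (h₂ : IsCosetDecomposition C₂ T₂ P₂)
    (hP₂ : P₂.Nonempty) {c c' : ι → ZMod 2} (hc : c ∈ P₁) (hc' : c' ∈ P₁) (hcc' : c - c' ∉ C₁) :
    hammingDist c c' ∈ undetectedWeights (cssUnionCode C₁ C₂ T₁ T₂) := by
  obtain ⟨t, ht, htc⟩ := (h₁.1 c).1 hc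
  obtain ⟨t', ht', htc'⟩ := (h₁.1 c').1 hc'
  obtain ⟨t₂, ht₂, -⟩ := (h₂.1 _).1 hP₂.some_mem
  refine ⟨c - c', 0, by rw [pauliWeight_zero_right, hammingDist_comm, hammingDist_eq_hammingNorm,
    neg_add_eq_sub], ?_⟩
  rw [cssUnionCode, unionCode_cssCode]
  refine not_detects_iSup_pauliEigenspace (isPhaseFree_prod_dualCode hC) (p := (c - c', 0))
    (t := (t', t₂)) (t' := (t, t₂)) ⟨ht', ht₂⟩ ⟨ht, ht₂⟩ ?_ ?_
  · rw [symplecticForm_orthogonal_prod_dualCode]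
    exact fun hmem => hcc' hmem.1
  · rw [symplecticForm_orthogonal_prod_dualCode]
    have hsplit : c - c' + t' - t = (c - t) - (c' - t') := by abel
    have hfst : c - c' + t' - t ∈ C₁ := hsplit ▸ C₁.sub_mem htc htc'
    exact ⟨hfst, by simp⟩

lemma not_isStabilizerCode_cssUnionCode (hC : dualCode C₂ ≤ C₁)
    (h₁ : IsCosetDecomposition C₁ T₁ P₁) (h₂ : IsCosetDecomposition C₂ T₂ P₂)
    (hP₂ : P₂.Nonempty) {c c' c'' : ι → ZMod 2} (hc : c ∈ P₁) (hc' : c' ∈ P₁) (hc'' : c'' ∈ P₁)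
    (hnot : c - c' + c'' ∉ P₁) : ¬ IsStabilizerCode (cssUnionCode C₁ C₂ T₁ T₂) := by
  obtain ⟨t, ht, htc⟩ := (h₁.1 c).1 hc
  obtain ⟨t', ht', htc'⟩ := (h₁.1 c').1 hc'
  obtain ⟨t'', ht'', htc''⟩ := (h₁.1 c'').1 hc''
  obtain ⟨t₂, ht₂, -⟩ := (h₂.1 _).1 hP₂.some_mem
  rw [cssUnionCode, unionCode_cssCode]
  refine not_isStabilizerCode_iSup_pauliEigenspace (isPhaseFree_prod_dualCode hC)
    (p := (c - c', 0)) (t := (t', t₂)) (t' := (t, t₂)) (t'' := (t'', t₂)) ⟨ht', ht₂⟩ ⟨ht, ht₂⟩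
    ⟨ht'', ht₂⟩ ?_ fun u hu hmem => hnot ((h₁.1 _).2 ⟨u.1, hu.1, ?_⟩)
  · rw [symplecticForm_orthogonal_prod_dualCode]
    have hsplit : c - c' + t' - t = (c - t) - (c' - t') := by abel
    have hfst : c - c' + t' - t ∈ C₁ := hsplit ▸ C₁.sub_mem htc htc'
    exact ⟨hfst, by simp⟩
  · rw [symplecticForm_orthogonal_prod_dualCode] at hmem
    have hsplit : c - c' + c'' - u.1 = (c - c' + t'' - u.1) + (c'' - t'') := by abel
    exact hsplit ▸ C₁.add_mem hmem.1 htc''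

end CssUnion

/-! ### Enlarged CSS codes -/

section Enlarged

variable {ι : Type*} {C C' D : Submodule (ZMod 2) (ι → ZMod 2)}
  {A : D ≃ₗ[ZMod 2] D}

lemma IsEnlargementData.mem_and_ne_zero (h : IsEnlargementData C C' D A) {a : ι → ZMod 2} {u : D}
    (ha : a - u ∈ C) (hu : u ≠ 0) : a ∈ C' ∧ a ≠ 0 := by
  have hcancel : a - u + u = a := sub_add_cancel a _
  refine ⟨h.2.1 ▸ hcancel ▸ Submodule.add_mem_sup ha u.2, ?_⟩
  rintro rfl
  rw [zero_sub, neg_mem_iff] at ha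
  exact hu (Subtype.ext ((Submodule.disjoint_def.1 (disjoint_iff.2 h.1)) _ ha u.2))

variable [Fintype ι]

lemma IsEnlargementData.le_pauliWeight (h : IsEnlargementData C C' D A) {d d' : ℕ}
    (hd : ∀ c ∈ C, c ≠ 0 → d ≤ hammingNorm c) (hd' : ∀ c ∈ C', c ≠ 0 → d' ≤ hammingNorm c)
    (hdd' : 2 * d ≤ 3 * d') {a b : ι → ZMod 2} {u : D} (ha : a - u ∈ C) (hb : b - A u ∈ C)
    (hab : ¬ (a = 0 ∧ b = 0)) : d ≤ pauliWeight a b := by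
  by_cases hu : u = 0
  · rw [hu, map_zero, ZeroMemClass.coe_zero, sub_zero] at hb
    rw [hu, ZeroMemClass.coe_zero, sub_zero] at ha
    rcases not_and_or.1 hab with ha0 | hb0
    · exact (hd a ha ha0).trans (hammingNorm_fst_le_pauliWeight a b)
    · exact (hd b hb hb0).trans (hammingNorm_snd_le_pauliWeight a b)
  have hAu : A u ≠ 0 := (map_ne_zero_iff A A.injective).2 hu
  have huAu : u + A u ≠ 0 := fun hsum =>
    hu (h.2.2 u (by rw [← sub_eq_zero, ZModModule.sub_eq_add, add_comm, hsum]))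
  have hsum : a + b - (u + A u : D) ∈ C := by
    rw [Submodule.coe_add, add_sub_add_comm]
    exact C.add_mem ha hb
  have hwa := hd' a (h.mem_and_ne_zero ha hu).1 (h.mem_and_ne_zero ha hu).2
  have hwb := hd' b (h.mem_and_ne_zero hb hAu).1 (h.mem_and_ne_zero hb hAu).2
  have hwab := hd' _ (h.mem_and_ne_zero hsum huAu).1 (h.mem_and_ne_zero hsum huAu).2
  have htriple := hammingNorm_add_hammingNorm_add a b
  omega

variable [DecidableEq ι]

/-- The translations `(v | A v)` form a subspace, so the union code is again a joint eigenspace. -/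
lemma isStabilizerCode_enlargedCode (hC : dualCode C ≤ C) (D : Submodule (ZMod 2) (ι → ZMod 2))
    (A : D ≃ₗ[ZMod 2] D) : IsStabilizerCode (enlargedCode C D A) := by
  let L : Submodule (ZMod 2) (PhaseSpace ι) :=
    LinearMap.range (D.subtype.prod (D.subtype ∘ₗ A.toLinearMap))
  have hL : {t : PhaseSpace ι | ∃ v : D, t = ((v : ι → ZMod 2), (A v : ι → ZMod 2))} = L := by
    ext t
    exact exists_congr fun v => eq_comm
  have hS := isPhaseFree_prod_dualCode hC
  rw [enlargedCode, unionCode_cssCode, hL]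
  simp only [SetLike.mem_coe]
  rw [iSup_pauliEigenspace hS]
  exact isStabilizerCode_pauliEigenspace_zero (hS.mono inf_le_left)

lemma finrank_enlargedCode (h : Disjoint C D) (A : D ≃ₗ[ZMod 2] D) :
    Module.finrank ℂ (enlargedCode C D A) =
      2 ^ Module.finrank (ZMod 2) D * Module.finrank ℂ (cssCode C C) := by
  classical
  let g : D ↪ PhaseSpace ι :=
    ⟨fun v => (v, A v), fun v v' hvv' => Subtype.ext (congrArg Prod.fst hvv')⟩
  have hT : {t : PhaseSpace ι | ∃ v : D, t = ((v : ι → ZMod 2), (A v : ι → ZMod 2))} =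
      ↑(Finset.univ.map g) := by
    ext t
    simp only [Finset.coe_map, Finset.coe_univ, Set.image_univ]
    exact exists_congr fun v => eq_comm
  rw [enlargedCode, hT, finrank_unionCode_cssCode, Finset.card_map, Finset.card_univ,
    Module.card_eq_pow_finrank (K := ZMod 2), ZMod.card]
  rintro _ ht _ ht' hne hmem
  simp only [Finset.coe_map, Finset.coe_univ, Set.image_univ, Set.mem_range] at ht ht'
  obtain ⟨⟨v, rfl⟩, v', rfl⟩ := And.intro ht ht'
  refine hne (congrArg g (Subtype.ext (sub_eq_zero.1 ?_)))
  exact Submodule.disjoint_def.1 h _ hmem.1 (D.sub_mem v.2 v'.2)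

lemma le_of_mem_undetectedWeights_enlargedCode {d d' w : ℕ} (h : IsEnlargementData C C' D A)
    (hd : ∀ c ∈ C, c ≠ 0 → d ≤ hammingNorm c) (hd' : ∀ c ∈ C', c ≠ 0 → d' ≤ hammingNorm c)
    (hdd' : 2 * d ≤ 3 * d') (hw : w ∈ undetectedWeights (enlargedCode C D A)) : d ≤ w := by
  obtain ⟨a, b, rfl, hdet⟩ := hw
  contrapose! hdet
  by_cases hab : a = 0 ∧ b = 0
  · rw [hab.1, hab.2]
    exact detects_pauliOp_zero _
  refine detects_unionCode_cssCode (p := (a, b)) ?_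
  rintro _ ⟨v, rfl⟩ _ ⟨v', rfl⟩ hmem
  have ha : a - (v' - v : D) ∈ C := by
    rw [Submodule.coe_sub, sub_sub_eq_add_sub]
    exact hmem.1
  have hb : b - A (v' - v) ∈ C := by
    rw [map_sub, Submodule.coe_sub, sub_sub_eq_add_sub]
    exact hmem.2
  exact absurd (h.le_pauliWeight hd hd' hdd' ha hb hab) (by omega)

end Enlarged

/-! ### Quantum codes from Reed–Muller and Preparata codes -/

lemma sum_range_two_choose (m : ℕ) : ∑ i ∈ Finset.range 2, m.choose i = 1 + m := by
  rw [Finset.sum_range_succ, Finset.sum_range_one, Nat.choose_zero_right, Nat.choose_one_right]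

lemma sum_range_three_choose (m : ℕ) : ∑ i ∈ Finset.range 3, m.choose i = 1 + m + m.choose 2 := by
  rw [Finset.sum_range_succ, sum_range_two_choose]

lemma two_mul_le_choose_two {m : ℕ} (hm : 5 ≤ m) : 2 * m ≤ m.choose 2 := by
  rw [Nat.choose_two_right, Nat.le_div_iff_mul_le two_pos]
  calc 2 * m * 2 = m * 4 := by ring
    _ ≤ m * (m - 1) := Nat.mul_le_mul_left m (by omega)

section QuantumReedMuller

variable {m r k : ℕ} {D : Submodule (ZMod 2) ((Fin m → ZMod 2) → ZMod 2)} {A : D ≃ₗ[ZMod 2] D}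

lemma dualCode_reedMuller_le (h : r + k + 1 = m) (hkr : k ≤ r) :
    dualCode (reedMuller r m) ≤ reedMuller r m :=
  (dualCode_reedMuller h).trans_le (reedMuller_mono hkr)

lemma two_pow_le_hammingNorm_of_mem_reedMuller (h : r + k + 1 = m)
    {f : (Fin m → ZMod 2) → ZMod 2} (hf : f ∈ reedMuller r m) (hf0 : f ≠ 0) :
    2 ^ (k + 1) ≤ hammingNorm f := by
  rw [← dualCode_reedMuller (by omega : k + r + 1 = m)] at hf
  exact two_pow_le_hammingNorm_of_mem_dualCode_reedMuller hf hf0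

lemma two_mul_sum_choose_le (h : r + k + 1 = m) (hkr : k ≤ r) :
    2 * ∑ i ∈ Finset.range (k + 1), m.choose i ≤ 2 ^ m := by
  have hsum := finrank_reedMuller_add_finrank_reedMuller h
  have hle := Submodule.finrank_mono (reedMuller_mono (m := m) hkr)
  rw [finrank_reedMuller k m] at hsum hle
  omega

lemma finrank_cssCode_reedMuller (h : r + k + 1 = m) (hkr : k ≤ r) :
    Module.finrank ℂ (cssCode (reedMuller r m) (reedMuller r m)) =
      2 ^ (2 ^ m - 2 * ∑ i ∈ Finset.range (k + 1), m.choose i) := by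
  have hsum := finrank_reedMuller_add_finrank_reedMuller h
  rw [finrank_reedMuller k m] at hsum
  rw [finrank_cssCode (dualCode_reedMuller_le h hkr), Fintype.card_fun, ZMod.card,
    Fintype.card_fin]
  congr 1
  omega

lemma finrank_complement_reedMuller
    (hD : IsEnlargementData (reedMuller r m) (reedMuller (r + 1) m) D A) :
    Module.finrank (ZMod 2) D = m.choose (r + 1) := by
  have hsum := Submodule.finrank_sup_add_finrank_inf_eq (reedMuller r m) D
  rw [hD.1, hD.2.1, finrank_bot, finrank_reedMuller, finrank_reedMuller,
    Finset.sum_range_succ _ (r + 1)] at hsum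
  omega

theorem finrank_enlargedCode_reedMuller (h : r + k + 1 = m) (hkr : k ≤ r)
    (hD : IsEnlargementData (reedMuller r m) (reedMuller (r + 1) m) D A) :
    Module.finrank ℂ (enlargedCode (reedMuller r m) D A) =
      2 ^ (2 ^ m - m.choose k - 2 * ∑ i ∈ Finset.range k, m.choose i) := by
  have hle := two_mul_sum_choose_le h hkr
  rw [finrank_enlargedCode (disjoint_iff.2 hD.1), finrank_complement_reedMuller hD,
    finrank_cssCode_reedMuller h hkr, ← pow_add, Nat.choose_symm_of_eq_add (by omega : m = _ + k)]
  rw [Finset.sum_range_succ] at hle ⊢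
  congr 1
  omega

theorem three_mul_two_pow_le_of_mem_undetectedWeights_enlargedCode_reedMuller
    (h : r + k + 2 = m) (hD : IsEnlargementData (reedMuller r m) (reedMuller (r + 1) m) D A)
    {w : ℕ} (hw : w ∈ undetectedWeights (enlargedCode (reedMuller r m) D A)) : 3 * 2 ^ k ≤ w := by
  refine le_of_mem_undetectedWeights_enlargedCode (d' := 2 ^ (k + 1)) hD (fun c hc hc0 => ?_)
    (fun c hc hc0 => two_pow_le_hammingNorm_of_mem_reedMuller (by omega) hc hc0) (by omega) hw
  calc 3 * 2 ^ k ≤ 2 ^ (k + 2) := by rw [pow_add]; omega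
    _ ≤ hammingNorm c := two_pow_le_hammingNorm_of_mem_reedMuller (k := k + 1) (by omega) hc hc0

end QuantumReedMuller

section QuantumPreparata

variable {m s : ℕ} {F : Type*} [Field F] [Fintype F] [Algebra (ZMod 2) F]
  {e : (Fin m → ZMod 2) ≃ₗ[ZMod 2] F × ZMod 2} {T T₁ T₂ : Finset ((Fin m → ZMod 2) → ZMod 2)}

theorem card_of_isCosetDecomposition_preparata (hm : 5 ≤ m) (hF : Fintype.card F = 2 ^ (m - 1))
    (hn : Odd (m - 1)) (hs : s.Coprime (m - 1))
    (hT : IsCosetDecomposition (reedMuller (m - 3) m) T (preparata e s)) :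
    T.card = 2 ^ (m.choose 2 - m + 1) := by
  have hcard := hT.card_mul_card
  have hsum := finrank_reedMuller_add_finrank_reedMuller (by omega : m - 3 + 2 + 1 = m)
  have hle := two_mul_sum_choose_le (by omega : m - 3 + 2 + 1 = m) (by omega)
  have hchoose := two_mul_le_choose_two hm
  rw [finrank_reedMuller 2, sum_range_three_choose] at hsum
  rw [sum_range_three_choose] at hle
  rw [ncard_preparata hF hn (by omega) hs e, Module.natCard_eq_pow_finrank (K := ZMod 2),
    Nat.card_zmod, mul_pow_sub_one (by omega)] at hcard
  refine Nat.eq_of_mul_eq_mul_right (by positivity) (hcard.trans ?_)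
  rw [← pow_add]
  congr 1
  omega

lemma finrank_cssUnionCode_preparata (hm : 5 ≤ m) (hF : Fintype.card F = 2 ^ (m - 1))
    (hn : Odd (m - 1)) (hs : s.Coprime (m - 1))
    (h₁ : IsCosetDecomposition (reedMuller (m - 3) m) T₁ (preparata e s))
    (h₂ : IsCosetDecomposition (reedMuller (m - 3) m) T₂ (preparata e s)) :
    Module.finrank ℂ (cssUnionCode (reedMuller (m - 3) m) (reedMuller (m - 3) m) T₁ T₂) =
      2 ^ (2 ^ m - 4 * m) := by
  have h : m - 3 + 2 + 1 = m := by omega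
  have hle := two_mul_sum_choose_le h (by omega)
  have hchoose := two_mul_le_choose_two hm
  rw [sum_range_three_choose] at hle
  rw [finrank_cssUnionCode h₁ h₂, card_of_isCosetDecomposition_preparata hm hF hn hs h₁,
    card_of_isCosetDecomposition_preparata hm hF hn hs h₂,
    finrank_cssCode_reedMuller h (by omega), sum_range_three_choose, ← pow_add, ← pow_add]
  congr 1
  omega

/-- A codeword of weight six is not in `RM(m - 3, m)`, all of whose nonzero words have weight at
least eight. -/
lemma isLeast_undetectedWeights_cssUnionCode_preparata (hm : 6 ≤ m)
    (hF : Fintype.card F = 2 ^ (m - 1)) (hn : Odd (m - 1)) (hs : s.Coprime (m - 1))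
    (h₁ : IsCosetDecomposition (reedMuller (m - 3) m) T₁ (preparata e s))
    (h₂ : IsCosetDecomposition (reedMuller (m - 3) m) T₂ (preparata e s)) :
    IsLeast (undetectedWeights
      (cssUnionCode (reedMuller (m - 3) m) (reedMuller (m - 3) m) T₁ T₂)) 6 := by
  have h : m - 3 + 2 + 1 = m := by omega
  have hd := pairwise_six_le_hammingDist_preparata hF hn hs e
  obtain ⟨c, hc, hc6⟩ := exists_mem_preparata_hammingNorm_eq_six hF (by omega) hs e
  refine ⟨?_, fun w => le_of_mem_undetectedWeights_cssUnionCode h₁ h₂ hd hd⟩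
  rw [← hc6, ← hammingDist_zero_right]
  have h0 := zero_mem_preparata e s
  refine hammingDist_mem_undetectedWeights_cssUnionCode (dualCode_reedMuller_le h (by omega)) h₁ h₂
    ⟨0, h0⟩ hc h0 fun hcR => ?_
  rw [sub_zero] at hcR
  have h8 := two_pow_le_hammingNorm_of_mem_reedMuller h hcR (hammingNorm_ne_zero_iff.1 (by omega))
  omega

theorem isQuantumCode_cssUnionCode_preparata (hm : 6 ≤ m)
    (hF : Fintype.card F = 2 ^ (m - 1)) (hn : Odd (m - 1)) (hs : s.Coprime (m - 1))
    (h₁ : IsCosetDecomposition (reedMuller (m - 3) m) T₁ (preparata e s))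
    (h₂ : IsCosetDecomposition (reedMuller (m - 3) m) T₂ (preparata e s)) :
    IsQuantumCode (cssUnionCode (reedMuller (m - 3) m) (reedMuller (m - 3) m) T₁ T₂)
      (2 ^ m) (2 ^ (2 ^ m - 4 * m)) 6 :=
  ⟨by rw [Fintype.card_fun, ZMod.card, Fintype.card_fin],
    finrank_cssUnionCode_preparata (by omega) hF hn hs h₁ h₂,
    isLeast_undetectedWeights_cssUnionCode_preparata hm hF hn hs h₁ h₂⟩

theorem not_isStabilizerCode_cssUnionCode_preparata (hm : 5 ≤ m)
    (hF : Fintype.card F = 2 ^ (m - 1)) (hn : Odd (m - 1)) (hs : s.Coprime (m - 1))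
    (h₁ : IsCosetDecomposition (reedMuller (m - 3) m) T₁ (preparata e s))
    (h₂ : IsCosetDecomposition (reedMuller (m - 3) m) T₂ (preparata e s)) :
    ¬ IsStabilizerCode (cssUnionCode (reedMuller (m - 3) m) (reedMuller (m - 3) m) T₁ T₂) := by
  obtain ⟨c, hc, c', hc', hnot⟩ := exists_mem_preparata_add_notMem hF hn (by omega) hs e
  have h0 := zero_mem_preparata e s
  exact not_isStabilizerCode_cssUnionCode
    (dualCode_reedMuller_le (by omega : m - 3 + 2 + 1 = m) (by omega)) h₁ h₂ ⟨0, h0⟩ hc h0 hc'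
    (by rwa [sub_zero])

theorem finrank_enlargedCode_lt_finrank_cssUnionCode_preparata (hm : 5 ≤ m)
    (hF : Fintype.card F = 2 ^ (m - 1)) (hn : Odd (m - 1)) (hs : s.Coprime (m - 1))
    (h₁ : IsCosetDecomposition (reedMuller (m - 3) m) T₁ (preparata e s))
    (h₂ : IsCosetDecomposition (reedMuller (m - 3) m) T₂ (preparata e s))
    {D : Submodule (ZMod 2) ((Fin m → ZMod 2) → ZMod 2)} {A : D ≃ₗ[ZMod 2] D}
    (hD : IsEnlargementData (reedMuller (m - 3) m) (reedMuller (m - 3 + 1) m) D A) :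
    Module.finrank ℂ (enlargedCode (reedMuller (m - 3) m) D A) <
      Module.finrank ℂ
        (cssUnionCode (reedMuller (m - 3) m) (reedMuller (m - 3) m) T₁ T₂) := by
  have h : m - 3 + 2 + 1 = m := by omega
  have hle := two_mul_sum_choose_le h (by omega)
  have hchoose := two_mul_le_choose_two hm
  rw [sum_range_three_choose] at hle
  rw [finrank_cssUnionCode_preparata hm hF hn hs h₁ h₂,
    finrank_enlargedCode_reedMuller h (by omega) hD, sum_range_two_choose]
  exact Nat.pow_lt_pow_right one_lt_two (by omega)

end QuantumPreparata

end UnionCode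

theorem mainTheorem4 (m : ℕ) (hm : 6 ≤ m) (hm2 : Even m)
    {F : Type*} [Field F] [Fintype F] [Algebra (ZMod 2) F] (hF : Fintype.card F = 2 ^ (m - 1))
    (e : (Fin m → ZMod 2) ≃ₗ[ZMod 2] F × ZMod 2) (s : ℕ) (hs : Nat.Coprime s (m - 1)) :
    -- the Preparata code is a union of `K_P` cosets of `RM(m - 3, m)`
    (∃ T, IsCosetDecomposition (reedMuller (m - 3) m) T (preparata e s)) ∧
    (∀ T, IsCosetDecomposition (reedMuller (m - 3) m) T (preparata e s) →
      T.card = 2 ^ (m.choose 2 - m + 1)) ∧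
    -- the CSS construction applies to `RM(m - 3, m)`
    dualCode (reedMuller (m - 3) m) ≤ reedMuller (m - 3) m ∧
    -- the CSS-like union codes
    ∀ T₁ T₂ : Finset ((Fin m → ZMod 2) → ZMod 2),
      IsCosetDecomposition (reedMuller (m - 3) m) T₁ (preparata e s) →
      IsCosetDecomposition (reedMuller (m - 3) m) T₂ (preparata e s) →
      ∀ Q : Submodule ℂ (Qubits (Fin m → ZMod 2)),
        Q = cssUnionCode (reedMuller (m - 3) m) (reedMuller (m - 3) m) T₁ T₂ →
        Module.finrank ℂ Q = (2 ^ (m.choose 2 - m + 1)) ^ 2 *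
          Module.finrank ℂ (cssCode (reedMuller (m - 3) m) (reedMuller (m - 3) m)) ∧
        IsQuantumCode Q (2 ^ m) (2 ^ (2 ^ m - 4 * m)) 6 ∧
        ¬ IsStabilizerCode Q ∧
        (m = 6 → IsQuantumCode Q 64 (2 ^ 40) 6) ∧
        (m = 8 → IsQuantumCode Q 256 (2 ^ 224) 6) ∧
        -- comparison with the enlarged Reed-Muller stabilizer codes
        ∀ (D : Submodule (ZMod 2) ((Fin m → ZMod 2) → ZMod 2)) (A : D ≃ₗ[ZMod 2] D),
          IsEnlargementData (reedMuller (m - 3) m) (reedMuller (m - 2) m) D A →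
          ∀ Q₁ : Submodule ℂ (Qubits (Fin m → ZMod 2)),
            Q₁ = enlargedCode (reedMuller (m - 3) m) D A →
            IsStabilizerCode Q₁ ∧
            Module.finrank ℂ Q₁ = 2 ^ (2 ^ m - m.choose 2 - 2 * m - 2) ∧
            (∀ w ∈ undetectedWeights Q₁, 6 ≤ w) ∧
            Module.finrank ℂ Q₁ < Module.finrank ℂ Q := by
  have h : m - 3 + 2 + 1 = m := by omega
  have hm5 : 5 ≤ m := by omega
  have hn : Odd (m - 1) := Nat.Even.sub_odd (by omega) hm2 odd_one
  have hC : dualCode (reedMuller (m - 3) m) ≤ reedMuller (m - 3) m :=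
    dualCode_reedMuller_le h (by omega)
  have hcard {T} (hT : IsCosetDecomposition (reedMuller (m - 3) m) T (preparata e s)) :=
    card_of_isCosetDecomposition_preparata hm5 hF hn hs hT
  refine ⟨exists_isCosetDecomposition fun c hc f hf => add_mem_preparata (by omega) hc hf,
    fun _ => hcard, hC, ?_⟩
  rintro T₁ T₂ h₁ h₂ Q rfl
  have hQ := isQuantumCode_cssUnionCode_preparata hm hF hn hs h₁ h₂
  refine ⟨by rw [finrank_cssUnionCode h₁ h₂, hcard h₁, hcard h₂, sq], hQ,
    not_isStabilizerCode_cssUnionCode_preparata hm5 hF hn hs h₁ h₂, by rintro rfl; exact hQ,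
    by rintro rfl; exact hQ, ?_⟩
  rintro D A hD Q₁ rfl
  rw [show m - 2 = m - 3 + 1 by omega] at hD
  refine ⟨isStabilizerCode_enlargedCode hC D A, ?_,
    fun w hw => three_mul_two_pow_le_of_mem_undetectedWeights_enlargedCode_reedMuller
      (k := 1) (by omega) hD hw,
    finrank_enlargedCode_lt_finrank_cssUnionCode_preparata hm5 hF hn hs h₁ h₂ hD⟩
  rw [finrank_enlargedCode_reedMuller h (by omega) hD, sum_range_two_choose, mul_add, mul_one,
    add_comm, ← Nat.sub_sub]
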